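/- Let $1<q<\infty$ with $q\neq 2$, let $G=(V,E)$ be a finite simple graph with $V\neq\emptyset$, and let $p=(p_v)_{v\in V}$ be a family of points of $\mathbb{R}^2$ (a placement of $G$), where $\mathbb{R}^2$ carries the norm $\|\cdot\|_q$. The *rigidity matrix* $R_q(G,p)$ is the $|E|\times 2|V|$ real matrix whose row for an edge $vw$ has the entries $(p_v-p_w)^{(q-1)}$ in the two columns of $v$, $-(p_v-p_w)^{(q-1)}$ in the two columns of $w$, and $0$ elsewhere, where $a^{(k)}=(\operatorname{sgn}(a_1)|a_1|^k,\operatorname{sgn}(a_2)|a_2|^k)$. The framework $(G,p)$ is *regular* if $\operatorname{rank}R_q(G,p)\ge\operatorname{rank}R_q(G,p')$ for every placement $p'$ of $G$. An *infinitesimal flex* of $(G,p)$ is a family $u=(u_v)_{v\in V}$ in $\mathbb{R}^2$ such that $\|(p_v+tu_v)-(p_w+tu_w)\|_q-\|p_v-p_w\|_q=o(t)$ as $t\to0$ for every edge $vw\in E$. A *rigid motion* is a family of continuous paths $\gamma_x:[-1,1]\to\mathbb{R}^2$ $(x\in\mathbb{R}^2)$, each differentiable at $0$ with $\gamma_x(0)=x$,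 such that $\|\gamma_x(t)-\gamma_y(t)\|_q=\|x-y\|_q$ for all $x,y\in\mathbb{R}^2$ and $t\in[-1,1]$. A flex $u$ is *trivial* if there is a rigid motion with $u_v=\gamma_{p_v}'(0)$ for all $v\in V$. The framework $(G,p)$ is *infinitesimally rigid* if all its infinitesimal flexes are trivial, and *infinitesimally flexible* otherwise; it is *minimally infinitesimally rigid* if it is infinitesimally rigid and, for every edge $e\in E$, the framework $(G-e,p)$ is infinitesimally flexible. **Theorem.** If $(G,p)$ is regular, then $(G,p)$ is minimally infinitesimally rigid if and only if $G$ is $(2,2)$-tight, that is, $|E|=2|V|-2$ and $|E(H)|\le 2|V(H)|-2$ for every subgraph $H=(V(H),E(H))$ of $G$ with $V(H)\neq\emptyset$. -/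

import Mathlib

open scoped ENNReal Topology

namespace BarJoint

section NormedSpace

variable {V X : Type*} [NormedAddCommGroup X] [NormedSpace ℝ X]

/-- `u` is an infinitesimal flex of the framework `(G, p)`: the edge lengths of `(G, p + t u)`
differ from those of `(G, p)` by `o(t)` as `t → 0`. -/
def IsInfinitesimalFlex (G : SimpleGraph V) (p u : V → X) : Prop :=
  ∀ v w : V, G.Adj v w →
    (fun t : ℝ => ‖(p v + t • u v) - (p w + t • u w)‖ - ‖p v - p w‖) =o[𝓝 0] (fun t : ℝ => t)

/-- A rigid motion of `X`. Only the values of the paths on `[-1, 1]` matter. -/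
structure IsRigidMotion (γ : X → ℝ → X) : Prop where
  continuousOn : ∀ x, ContinuousOn (γ x) (Set.Icc (-1) 1)
  differentiableAt : ∀ x, DifferentiableAt ℝ (γ x) 0
  map_zero : ∀ x, γ x 0 = x
  norm_sub : ∀ t ∈ Set.Icc (-1 : ℝ) 1, ∀ x y, ‖γ x t - γ y t‖ = ‖x - y‖

/-- `u` is the restriction to the placement `p` of the vector field `x ↦ γ_x'(0)` of a rigid
motion. -/
def IsTrivial (p u : V → X) : Prop :=
  ∃ γ : X → ℝ → X, IsRigidMotion γ ∧ ∀ v, u v = deriv (γ (p v)) 0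

/-- `(G, p)` has a non-trivial infinitesimal flex. -/
def InfinitesimallyFlexible (G : SimpleGraph V) (p : V → X) : Prop :=
  ∃ u : V → X, IsInfinitesimalFlex G p u ∧ ¬ IsTrivial p u

/-- `(G, p)` has no non-trivial infinitesimal flex. -/
def InfinitesimallyRigid (G : SimpleGraph V) (p : V → X) : Prop :=
  ¬ InfinitesimallyFlexible G p

/-- `(G, p)` is infinitesimally rigid, and removing any single edge makes it flexible. -/
def MinimallyInfinitesimallyRigid (G : SimpleGraph V) (p : V → X) : Prop :=
  InfinitesimallyRigid G p ∧
    ∀ e ∈ G.edgeSet, InfinitesimallyFlexible (G.deleteEdges {e}) p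

end NormedSpace

section RigidityMatrix

/-- The signed power `sgn(a) |a|^k`. -/
noncomputable def signedPow (k a : ℝ) : ℝ := Real.sign a * |a| ^ k

theorem signedPow_neg (k a : ℝ) : signedPow k (-a) = -signedPow k a := by
  simp [signedPow, Real.sign_neg]

variable {V : Type*} [DecidableEq V] {d : ℕ}

/-- The entry of the rigidity matrix in the row of the edge `v_i v_j` and the column of the
`k`-th coordinate of the vertex `v`: the row carries `(p_i - p_j)^{(q-1)}` in the columns of `v_i`,
`-(p_i - p_j)^{(q-1)}` in the columns of `v_j`, and zeros elsewhere. This does not depend on the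
order of the two end points. -/
noncomputable def rigidityEntry (q : ℝ≥0∞) (p : V → PiLp q (fun _ : Fin d => ℝ))
    (e : Sym2 V) (v : V) (k : Fin d) : ℝ :=
  Sym2.lift ⟨fun i j =>
    (if v = i then signedPow (q.toReal - 1) (p i k - p j k) else 0) -
      (if v = j then signedPow (q.toReal - 1) (p i k - p j k) else 0), by
    intro i j
    have h : signedPow (q.toReal - 1) (p j k - p i k)
        = -signedPow (q.toReal - 1) (p i k - p j k) := by
      rw [← signedPow_neg, neg_sub]
    simp only [h]
    split_ifs <;> ring⟩ e

/-- The rigidity matrix `R_q(G, p)`, of size `|E| × d|V|`. -/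
noncomputable def rigidityMatrix (q : ℝ≥0∞) (G : SimpleGraph V)
    (p : V → PiLp q (fun _ : Fin d => ℝ)) : Matrix G.edgeSet (V × Fin d) ℝ :=
  Matrix.of fun e c => rigidityEntry q p e c.1 c.2

/-- `(G, p)` is regular: the rank of its rigidity matrix is maximal over all realisations
of `G`. -/
def IsRegular [Fintype V] (q : ℝ≥0∞) (G : SimpleGraph V)
    (p : V → PiLp q (fun _ : Fin d => ℝ)) : Prop :=
  ∀ p' : V → PiLp q (fun _ : Fin d => ℝ),
    (rigidityMatrix q G p').rank ≤ (rigidityMatrix q G p).rank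

end RigidityMatrix

/-- `|E(H)| ≤ 2|V(H)| - 2` for all (non-empty) subgraphs `H` of `G`. -/
def IsTwoTwoSparse {V : Type*} (G : SimpleGraph V) : Prop :=
  ∀ H : G.Subgraph, H.verts.Nonempty →
    (H.edgeSet.ncard : ℤ) ≤ 2 * (H.verts.ncard : ℤ) - 2

/-- `G` is `(2,2)`-sparse and `|E| = 2|V| - 2`. -/
def IsTwoTwoTight {V : Type*} (G : SimpleGraph V) : Prop :=
  IsTwoTwoSparse G ∧ (G.edgeSet.ncard : ℤ) = 2 * (Nat.card V : ℤ) - 2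

end BarJoint

namespace BarJoint

/-! ### Signed powers and edge directions. -/

section SignedPow

variable {r : ℝ}

/-! Write r = q - 1. Since the q-norm is differentiable away from the origin, the flex condition on
an edge of positive length is the linear equation of its row in the rigidity matrix. Because r ≠ 1,
rotations are excluded and the trivial flexes are exactly the constant fields (`isTrivial_iff`), a
space of dimension 2. A placement with independent rows is called stress-free.

Fields constant on a vertex set X satisfy every row inside X, so independent rows force at most 2|X|
- 2 edges there: stress-free implies (2,2)-sparse (`StressFree.adjSparse`). When equality holds, a
dimension count shows that every flex is constant on X (`StressFree.mem_constOn`).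

The main work is the converse: every (2,2)-sparse graph has some stress-free placement
(`AdjSparse.exists_stressFree`). By induction, a vertex of degree at most 2 is deleted, or a vertex
of degree 3 is deleted and an edge inserted between two of its neighbours. If no such edge can be
inserted, the vertex and its neighbours span a complete graph on four vertices. Either this is
everything, which is settled by an explicit placement where r ≠ 1 is essential, or a maximal proper
tight set around it is contracted. Stress-freeness is an open condition, so each step can be
reversed by a limiting or perturbed placement.

For a tight graph, regularity transfers independence to the given placement, and counting dimensions
gives minimal rigidity. For the other direction, let B be a row basis of the rigidity matrix. An
edge outside B must be shown redundant, so that minimality yields B = G. Edges of length zero are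
the delicate case: their row vanishes, yet the flex condition still forces equal velocities. There
regularity puts the two ends in a tight set of B, which already moves as one. -/

theorem signedPow_of_pos {x : ℝ} (hx : 0 < x) : signedPow r x = x ^ r := by
  rw [signedPow, Real.sign_of_pos hx, abs_of_pos hx, one_mul]

@[simp]
theorem signedPow_zero : signedPow r 0 = 0 := by simp [signedPow]

@[simp]
theorem signedPow_one : signedPow r 1 = 1 := by simp [signedPow]

theorem signedPow_mul (x y : ℝ) : signedPow r (x * y) = signedPow r x * signedPow r y := by
  have hs : Real.sign (x * y) = Real.sign x * Real.sign y := by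
    rcases lt_trichotomy x 0 with hx | rfl | hx <;> rcases lt_trichotomy y 0 with hy | rfl | hy <;>
      simp [Real.sign_of_neg, Real.sign_of_pos, mul_pos_of_neg_of_neg, mul_neg_of_neg_of_pos,
        mul_neg_of_pos_of_neg, *]
  rw [signedPow, signedPow, signedPow, hs, abs_mul, Real.mul_rpow (abs_nonneg _) (abs_nonneg _)]
  ring

theorem signedPow_injective (hr : 0 < r) : Function.Injective (signedPow r) := by
  intro x y h
  have key : ∀ z : ℝ, 0 ≤ z * signedPow r z ∧ |signedPow r z| = |z| ^ r := by
    intro z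
    rcases lt_trichotomy z 0 with hz | rfl | hz
    · have : 0 < |z| ^ r := Real.rpow_pos_of_pos (abs_pos.2 hz.ne) _
      simp only [signedPow, Real.sign_of_neg hz, neg_mul, one_mul, abs_neg, abs_of_pos this,
        and_true]
      nlinarith
    · simp [hr.ne']
    · have : 0 < |z| ^ r := Real.rpow_pos_of_pos (abs_pos.2 hz.ne') _
      simp only [signedPow, Real.sign_of_pos hz, one_mul, abs_of_pos this, and_true]
      positivity
  have habs : |x| = |y| := by
    have := (key x).2.symm.trans ((congrArg abs h).trans (key y).2)
    exact (Real.rpow_left_inj (abs_nonneg _) (abs_nonneg _) hr.ne').1 this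
  rcases abs_eq_abs.1 habs with hxy | hxy
  · exact hxy
  · subst hxy
    have h1 := (key (-y)).1
    rw [h] at h1
    have h2 := (key y).1
    have h3 : y * signedPow r y = 0 := by linarith
    rcases mul_eq_zero.1 h3 with h4 | h4
    · simp [h4]
    · have := (key y).2
      rw [h4, abs_zero, eq_comm, Real.rpow_eq_zero (abs_nonneg _) hr.ne', abs_eq_zero] at this
      simp [this]

theorem signedPow_eq_zero (hr : 0 < r) {x : ℝ} : signedPow r x = 0 ↔ x = 0 :=
  ⟨fun h => signedPow_injective hr (h.trans signedPow_zero.symm), fun h => by simp [h]⟩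

theorem continuous_signedPow (hr : 0 < r) : Continuous (signedPow r) := by
  -- Splitting into positive and negative parts avoids the jump of the sign; r > 0 makes both powers
  -- continuous at 0.
  have : signedPow r = fun x => (max x 0) ^ r - (max (-x) 0) ^ r := by
    funext x
    rcases lt_trichotomy x 0 with hx | rfl | hx
    · simp [signedPow, Real.sign_of_neg hx, abs_of_neg hx, hx.le, hr.ne']
    · simp
    · simp [signedPow, Real.sign_of_pos hx, abs_of_pos hx, hx.le, hr.ne']
  rw [this]
  exact ((continuous_id.max continuous_const).rpow_const fun _ => Or.inr hr.le).sub
    ((continuous_neg.max continuous_const).rpow_const fun _ => Or.inr hr.le)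

/-- The direction `(p_a - p_b)^{(r)}` attached to each ordered pair of vertices. -/
noncomputable def dirs {V : Type*} (r : ℝ) (p : V → Fin 2 → ℝ) (a b : V) (k : Fin 2) : ℝ :=
  signedPow r (p a k - p b k)

theorem dirs_swap {V : Type*} (p : V → Fin 2 → ℝ) (a b : V) (k : Fin 2) :
    dirs r p b a k = -dirs r p a b k := by
  rw [dirs, dirs, ← signedPow_neg, neg_sub]

/-- Two directions are parallel only if the underlying vectors are. -/
theorem signedPow_eq_zero_of_comb_eq_zero (hr : 0 < r) {x y : Fin 2 → ℝ}
    (hxy : x 0 * y 1 - x 1 * y 0 ≠ 0) {s t : ℝ}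
    (h : ∀ k, s * signedPow r (x k) + t * signedPow r (y k) = 0) : s = 0 ∧ t = 0 := by
  have hd : signedPow r (x 0) * signedPow r (y 1) - signedPow r (x 1) * signedPow r (y 0) ≠ 0 := by
    rw [← signedPow_mul, ← signedPow_mul]
    exact fun h0 => hxy (sub_eq_zero.2 (signedPow_injective hr (sub_eq_zero.1 h0)))
  have h0 := h 0
  have h1 := h 1
  constructor
  · refine (mul_eq_zero.1 (?_ : s * _ = 0)).resolve_right hd
    linear_combination signedPow r (y 1) * h0 - signedPow r (y 0) * h1
  · refine (mul_eq_zero.1 (?_ : t * _ = 0)).resolve_right hd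
    linear_combination signedPow r (x 0) * h1 - signedPow r (x 1) * h0

end SignedPow

/-! ### Equilibrium stresses and the openness of stress-freeness. -/

section Stress

variable {V : Type*} [Fintype V] {G : SimpleGraph V} {r : ℝ}

/-- The only equilibrium stress of `G` with respect to the edge directions `D` is zero. -/
def StressFree (G : SimpleGraph V) (D : V → V → Fin 2 → ℝ) : Prop :=
  ∀ ω : V → V → ℝ, (∀ a b, ω a b = ω b a) → (∀ a b, ¬ G.Adj a b → ω a b = 0) →
    (∀ a k, ∑ b, ω a b * D a b k = 0) → ∀ a b, ω a b = 0

/-- The symmetric weights supported on the edges of `G`. -/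
def stressSpace (G : SimpleGraph V) : Submodule ℝ (V → V → ℝ) where
  carrier := {ω | (∀ a b, ω a b = ω b a) ∧ ∀ a b, ¬ G.Adj a b → ω a b = 0}
  add_mem' := fun {x y} hx hy => ⟨fun a b => by simp [hx.1 a b, hy.1 a b],
    fun a b h => by simp [hx.2 a b h, hy.2 a b h]⟩
  zero_mem' := ⟨fun _ _ => rfl, fun _ _ _ => rfl⟩
  smul_mem' := fun c x hx => ⟨fun a b => by simp [hx.1 a b], fun a b h => by simp [hx.2 a b h]⟩

/-- The resultant forces of a stress, as a linear function of the directions and the stress. -/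
noncomputable def resultant (G : SimpleGraph V) :
    (V → V → Fin 2 → ℝ) →ₗ[ℝ] (stressSpace G →L[ℝ] (V → Fin 2 → ℝ)) where
  toFun D := LinearMap.toContinuousLinearMap
    { toFun := fun ω a k => ∑ b, ω.1 a b * D a b k
      map_add' := fun x y => by
        funext a k
        simp [add_mul, Finset.sum_add_distrib]
      map_smul' := fun c x => by
        funext a k
        simp [mul_assoc, Finset.mul_sum] }
  map_add' D D' := by
    ext ω a k
    simp [mul_add, Finset.sum_add_distrib]
  map_smul' c D := by
    ext ω a k
    simp [Finset.mul_sum, mul_left_comm]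

theorem stressFree_iff_injective {D : V → V → Fin 2 → ℝ} :
    StressFree G D ↔ Function.Injective (resultant G D) := by
  rw [injective_iff_map_eq_zero]
  constructor
  · intro h ω hω
    ext a b
    exact h ω.1 ω.2.1 ω.2.2 (fun a k => congrFun (congrFun hω a) k) a b
  · intro h ω h1 h2 h3 a b
    have := h ⟨ω, h1, h2⟩ (by funext a k; exact h3 a k)
    exact congrFun (congrFun (congrArg Subtype.val this) a) b

/-- Injective operators out of a finite-dimensional space form an open set, and the resultant
depends linearly on the directions. All perturbation arguments rest on this. -/
theorem isOpen_stressFree (G : SimpleGraph V) :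
    IsOpen {D : V → V → Fin 2 → ℝ | StressFree G D} := by
  simp_rw [stressFree_iff_injective]
  exact (ContinuousLinearMap.isOpen_injective (𝕜 := ℝ) (E := stressSpace G)
    (F := V → Fin 2 → ℝ)).preimage (resultant G).continuous_of_finiteDimensional

/-- Freeness is not affected by rescaling the directions of the edges. -/
theorem StressFree.of_scale {D D' : V → V → Fin 2 → ℝ} (h : StressFree G D) (c : V → V → ℝ)
    (hc : ∀ a b, c a b ≠ 0) (hs : ∀ a b, c a b = c b a)
    (hD : ∀ a b k, D a b k = c a b * D' a b k) : StressFree G D' := by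
  intro ω h1 h2 h3 a b
  have := h (fun a b => ω a b / c a b) (fun a b => by rw [h1 a b, hs a b])
    (fun a b hab => by simp [h2 a b hab]) (fun a k => by
      rw [← h3 a k]
      refine Finset.sum_congr rfl fun b _ => ?_
      rw [hD, ← mul_assoc, div_mul_cancel₀ _ (hc a b)]) a b
  exact (div_eq_zero_iff.1 this).resolve_right (hc a b)

theorem StressFree.mono {H : SimpleGraph V} {D : V → V → Fin 2 → ℝ} (h : StressFree G D)
    (hH : H ≤ G) : StressFree H D :=
  fun ω h1 h2 h3 => h ω h1 (fun a b hab => h2 a b fun h' => hab (hH h')) h3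

/-- A vertex may be moved a little in any direction. -/
theorem StressFree.eventually_update [DecidableEq V] (hr : 0 < r) {p : V → Fin 2 → ℝ}
    (h : StressFree G (dirs r p)) (c : V) (n : Fin 2 → ℝ) :
    ∀ᶠ t : ℝ in 𝓝 0, StressFree G (dirs r (Function.update p c (p c + t • n))) := by
  have hcont : Continuous fun t : ℝ => dirs r (Function.update p c (p c + t • n)) := by
    have h0 : Continuous fun t : ℝ => Function.update p c (p c + t • n) :=
      continuous_const.update c (by fun_prop)
    refine continuous_pi fun a => continuous_pi fun b => continuous_pi fun k => ?_
    refine (continuous_signedPow hr).comp ?_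
    have hx : ∀ x, Continuous fun t : ℝ => Function.update p c (p c + t • n) x k := fun x =>
      (continuous_apply k).comp ((continuous_apply x).comp h0)
    exact (hx a).sub (hx b)
  refine hcont.continuousAt.eventually_mem ((isOpen_stressFree G).mem_nhds ?_)
  simpa using h

theorem StressFree.exists_update [DecidableEq V] (hr : 0 < r) {p : V → Fin 2 → ℝ}
    (h : StressFree G (dirs r p)) (c : V) (n : Fin 2 → ℝ) :
    ∃ t : ℝ, t ≠ 0 ∧ StressFree G (dirs r (Function.update p c (p c + t • n))) := by
  have := ((h.eventually_update hr c n).filter_mono (nhdsWithin_le_nhds (s := {0}ᶜ))).and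
    self_mem_nhdsWithin
  obtain ⟨t, ht, ht'⟩ := this.exists
  exact ⟨t, ht', ht⟩

end Stress

/-! ### Graph moves that preserve the existence of a stress-free placement. -/

section Moves

variable {V : Type*} [Fintype V] {G H : SimpleGraph V} {r : ℝ}

theorem StressFree.congr {D D' : V → V → Fin 2 → ℝ} (h : StressFree G D)
    (hD : ∀ a b, G.Adj a b → D a b = D' a b) : StressFree G D' := by
  intro ω h1 h2 h3
  refine h ω h1 h2 fun a k => ?_
  rw [← h3 a k]
  refine Finset.sum_congr rfl fun b _ => ?_
  by_cases hab : G.Adj a b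
  · rw [hD a b hab]
  · rw [h2 a b hab, zero_mul, zero_mul]

theorem StressFree.update_of_isolated [DecidableEq V] {p : V → Fin 2 → ℝ}
    (h : StressFree G (dirs r p)) {v : V} (hv : ∀ x, ¬ G.Adj v x) (y : Fin 2 → ℝ) :
    StressFree G (dirs r (Function.update p v y)) := by
  refine h.congr fun a b hab => ?_
  have ha : a ≠ v := by rintro rfl; exact hv _ hab
  have hb : b ≠ v := by rintro rfl; exact hv _ hab.symm
  funext k
  simp [dirs, ha, hb]

/-- An edge of length zero has zero direction, so unit weight on it alone would be a stress. -/
theorem StressFree.ne_of_adj {p : V → Fin 2 → ℝ} (h : StressFree G (dirs r p)) {a b : V}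
    (hab : G.Adj a b) : p a ≠ p b := by
  classical
  intro hp
  have := h (fun x y => if (x = a ∧ y = b) ∨ (x = b ∧ y = a) then 1 else 0)
    (fun x y => by congr 1; simp only [eq_iff_iff]; tauto)
    (fun x y hxy => if_neg (by
      rintro (⟨rfl, rfl⟩ | ⟨rfl, rfl⟩)
      · exact hxy hab
      · exact hxy hab.symm))
    (fun x k => Finset.sum_eq_zero fun y _ => by
      split_ifs with hxy
      · rcases hxy with ⟨rfl, rfl⟩ | ⟨rfl, rfl⟩ <;> simp [dirs, hp]
      · simp) a b
  simp at this

/-- Adding a vertex whose edges have independent directions preserves freeness. -/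
theorem StressFree.add_vertex {D : V → V → Fin 2 → ℝ} (h : StressFree H D) {v : V}
    (hG : ∀ a b, G.Adj a b → a ≠ v → b ≠ v → H.Adj a b)
    (hv : ∀ c : V → ℝ, (∀ x, ¬ G.Adj v x → c x = 0) → (∀ k, ∑ x, c x * D v x k = 0) →
      ∀ x, c x = 0) : StressFree G D := by
  intro ω h1 h2 h3
  have hω := hv (ω v) (h2 v) (h3 v)
  refine h ω h1 (fun a b hab => ?_) h3
  by_cases ha : a = v
  · exact ha ▸ hω b
  by_cases hb : b = v
  · rw [h1, hb, hω a]
  exact h2 a b fun hab' => hab (hG a b hab' ha hb)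

/-- The vertex v is placed off the line through a and b, so that its at most two edges have
independent directions. Allowing a = b covers degree one. -/
theorem exists_stressFree_of_pair (hr : 0 < r) {v a b : V} (ha : a ≠ v) (hb : b ≠ v)
    (hH : ∃ p, StressFree H (dirs r p)) (hHv : ∀ x, ¬ H.Adj v x)
    (hG : ∀ a b, G.Adj a b → a ≠ v → b ≠ v → H.Adj a b)
    (hN : ∀ x, G.Adj v x → x = a ∨ x = b) : ∃ p, StressFree G (dirs r p) := by
  classical
  obtain ⟨p, hp⟩ := hH
  by_cases hab : a = b
  · subst hab
    refine ⟨_, (hp.update_of_isolated hHv (p a + 1)).add_vertex hG fun c hc hs => ?_⟩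
    have hca : c a = 0 := by
      have := hs 0
      rw [Fintype.sum_eq_single a (fun x hx => by
        rw [hc x fun h => hx (by simpa using hN x h), zero_mul])] at this
      simpa [dirs, ha] using this
    intro x
    by_cases hx : x = a
    · rw [hx, hca]
    · exact hc x fun h => hx (by simpa using hN x h)
  obtain ⟨p, hp, hne⟩ : ∃ p, StressFree H (dirs r p) ∧ p a ≠ p b := by
    by_cases hpab : p a = p b
    · obtain ⟨t, ht, hpt⟩ := hp.exists_update hr a 1
      refine ⟨_, hpt, fun h => ht ?_⟩
      simpa [Ne.symm hab, hpab] using congrFun h 0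
    · exact ⟨p, hp, hpab⟩
  -- With n the quarter turn of b - a, the determinant of v - a and v - b is |b - a|² in the
  -- Euclidean sense.
  obtain ⟨n, hn0, hn1⟩ : ∃ n : Fin 2 → ℝ, n 0 = -(p b 1 - p a 1) ∧ n 1 = p b 0 - p a 0 :=
    ⟨![_, _], rfl, rfl⟩
  refine ⟨_, (hp.update_of_isolated hHv (p a + n)).add_vertex hG fun c hc hs => ?_⟩
  have hcx : ∀ x, x ≠ a ∧ x ≠ b → c x = 0 := fun x hx =>
    hc x fun h => (hN x h).elim hx.1 hx.2
  have hs' : ∀ k, c a * signedPow r (n k) + c b * signedPow r (p a k + n k - p b k) = 0 := by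
    intro k
    rw [← hs k, Fintype.sum_eq_add a b hab (fun x hx => by rw [hcx x hx, zero_mul])]
    simp [dirs, ha, hb]
  have hsq : (p b 0 - p a 0) ^ 2 + (p b 1 - p a 1) ^ 2 ≠ 0 := by
    intro h0
    refine hne (funext fun k => ?_)
    fin_cases k
    · simp only [Fin.zero_eta]; nlinarith [sq_nonneg (p b 0 - p a 0), sq_nonneg (p b 1 - p a 1)]
    · simp only [Fin.mk_one]; nlinarith [sq_nonneg (p b 0 - p a 0), sq_nonneg (p b 1 - p a 1)]
  obtain ⟨hca, hcb⟩ := signedPow_eq_zero_of_comb_eq_zero hr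
    (x := n) (y := fun k => p a k + n k - p b k) (by
      convert hsq using 1
      rw [hn0, hn1]
      ring) hs'
  intro x
  by_cases hxa : x = a
  · rw [hxa, hca]
  by_cases hxb : x = b
  · rw [hxb, hcb]
  exact hcx x ⟨hxa, hxb⟩

/-- The Henneberg 2-move: the edge `ab` of `H` is subdivided by `v`, which is joined to `c`. -/
theorem exists_stressFree_of_subdivision (hr : 0 < r) {v a b c : V}
    (ha : a ≠ v) (hb : b ≠ v) (hc : c ≠ v) (hca : c ≠ a) (hcb : c ≠ b)
    (hH : ∃ p, StressFree H (dirs r p)) (hHv : ∀ x, ¬ H.Adj v x) (hHab : H.Adj a b)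
    (hGab : ¬ G.Adj a b) (hG : ∀ a b, G.Adj a b → a ≠ v → b ≠ v → H.Adj a b)
    (hN : ∀ x, G.Adj v x → x = a ∨ x = b ∨ x = c) : ∃ p, StressFree G (dirs r p) := by
  classical
  obtain ⟨p, hp⟩ := hH
  have hab : a ≠ b := hHab.ne
  obtain ⟨p, hp, hdet⟩ : ∃ p, StressFree H (dirs r p) ∧
      (p b 0 - p a 0) * (p c 1 - p a 1) - (p b 1 - p a 1) * (p c 0 - p a 0) ≠ 0 := by
    by_cases hdet : (p b 0 - p a 0) * (p c 1 - p a 1) - (p b 1 - p a 1) * (p c 0 - p a 0) = 0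
    -- If c is collinear with a and b, moving it perpendicularly by t changes the determinant by t
    -- |b - a|², which is nonzero because ab is an edge of H.
    · obtain ⟨n, hn0, hn1⟩ : ∃ n : Fin 2 → ℝ, n 0 = -(p b 1 - p a 1) ∧ n 1 = p b 0 - p a 0 :=
        ⟨![_, _], rfl, rfl⟩
      obtain ⟨t, ht, hpt⟩ := hp.exists_update hr c n
      refine ⟨_, hpt, fun h => ?_⟩
      have h0 : t * ((p b 0 - p a 0) ^ 2 + (p b 1 - p a 1) ^ 2) = 0 := by
        simp [hca.symm, hcb.symm, hn0, hn1] at h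
        linear_combination h - hdet
      have h1 := (mul_eq_zero.1 h0).resolve_left ht
      refine hp.ne_of_adj hHab (funext fun k => ?_)
      fin_cases k
      · simp only [Fin.zero_eta]
        nlinarith [sq_nonneg (p b 0 - p a 0), sq_nonneg (p b 1 - p a 1)]
      · simp only [Fin.mk_one]
        nlinarith [sq_nonneg (p b 0 - p a 0), sq_nonneg (p b 1 - p a 1)]
    · exact ⟨p, hp, hdet⟩
  -- At the midpoint, va and vb are parallel to ab with the common ratio h below, while vc is not.
  -- Equilibrium at v then forces equal weights on va and vb and weight zero on vc.
  set p' := Function.update p v (fun k => (p a k + p b k) / 2) with hp'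
  have hfree : StressFree H (dirs r p') := hp.update_of_isolated hHv _
  have hv' : ∀ k, p' v k = (p a k + p b k) / 2 := fun k => by simp [hp']
  have hne' : ∀ x, x ≠ v → p' x = p x := fun x hx => by simp [hp', hx]
  set h := signedPow r (1 / 2) with hh
  have hh0 : h ≠ 0 := fun h0 => by
    have := (signedPow_eq_zero hr).1 h0
    norm_num at this
  have hav : ∀ k, dirs r p' a v k = h * dirs r p' a b k := fun k => by
    rw [dirs, dirs, hh, ← signedPow_mul, hv', hne' a ha, hne' b hb]
    congr 1; ring
  have hbv : ∀ k, dirs r p' b v k = h * dirs r p' b a k := fun k => by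
    rw [dirs, dirs, hh, ← signedPow_mul, hv', hne' a ha, hne' b hb]
    congr 1; ring
  refine ⟨p', fun ω h1 h2 h3 => ?_⟩
  have hvx : ∀ x, x ≠ a ∧ x ≠ b ∧ x ≠ c → ω v x = 0 := fun x hx =>
    h2 v x fun hadj => by rcases hN x hadj with h | h | h <;> tauto
  have hsv : ∀ k, (ω v a - ω v b) * h * signedPow r (p b k - p a k) +
      ω v c * signedPow r ((p a k + p b k) / 2 - p c k) = 0 := by
    intro k
    rw [← h3 v k, ← Finset.sum_subset (Finset.subset_univ {a, b, c})
      (fun x _ hx => by rw [hvx x (by simpa using hx), zero_mul]),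
      Finset.sum_insert (by simp [hab, hca.symm]), Finset.sum_insert (by simp [hcb.symm]),
      Finset.sum_singleton, dirs_swap p' a v, dirs_swap p' b v, hav, hbv, dirs_swap p' b a]
    simp only [dirs, hv', hne' a ha, hne' b hb, hne' c hc]
    ring
  obtain ⟨hab0, hvc⟩ := signedPow_eq_zero_of_comb_eq_zero hr (x := fun k => p b k - p a k)
    (y := fun k => (p a k + p b k) / 2 - p c k) (fun h0 => hdet (by linear_combination -h0)) hsv
  have hvab : ω v a = ω v b := sub_eq_zero.1 ((mul_eq_zero.1 hab0).resolve_right hh0)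
  -- The path a, v, b is replaced by the edge ab with weight h times that of va, which exerts the
  -- same forces at a and b; the result is a stress of H.
  have hω' := hfree (fun x y => (if x = v ∨ y = v then 0 else ω x y) +
      if (x = a ∧ y = b) ∨ (x = b ∧ y = a) then h * ω v a else 0)
    (fun x y => by
      congr 1
      · by_cases hx : x = v <;> by_cases hy : y = v <;> simp [hx, hy, h1 x y]
      · congr 1; simp only [eq_iff_iff]; tauto)
    (fun x y hxy => by
      have hpair : ¬ ((x = a ∧ y = b) ∨ (x = b ∧ y = a)) := by
        rintro (⟨rfl, rfl⟩ | ⟨rfl, rfl⟩)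
        · exact hxy hHab
        · exact hxy hHab.symm
      rw [if_neg hpair, add_zero]
      split_ifs with hv
      · rfl
      · push Not at hv
        exact h2 x y fun hadj => hxy (hG x y hadj hv.1 hv.2))
    (fun x k => by
      by_cases hxv : x = v
      · subst hxv
        simp [ha.symm, hb.symm]
      have hterm : ∀ y, ((if x = v ∨ y = v then 0 else ω x y) +
          if (x = a ∧ y = b) ∨ (x = b ∧ y = a) then h * ω v a else 0) * dirs r p' x y k =
          ω x y * dirs r p' x y k - (if y = v then ω x v * dirs r p' x v k else 0) +
          (if y = b then (if x = a then h * ω v a * dirs r p' a b k else 0) else 0) +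
          (if y = a then (if x = b then h * ω v a * dirs r p' b a k else 0) else 0) := by
        intro y
        by_cases hyv : y = v
        · subst hyv
          simp [ha.symm, hb.symm]
        by_cases hxa : x = a
        · subst hxa
          by_cases hyb : y = b
          · subst hyb; simp [hxv, hyv, hab, hab.symm]; ring
          · simp [hxv, hyv, hab, hyb]
        by_cases hxb : x = b
        · subst hxb
          by_cases hya : y = a
          · subst hya; simp [hxv, hyv, hab, hab.symm]; ring
          · simp [hxv, hyv, hab.symm, hya]
        simp [hxv, hyv, hxa, hxb]
      simp only [hterm, Finset.sum_add_distrib, Finset.sum_sub_distrib, Finset.sum_ite_eq',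
        Finset.mem_univ, if_true, h3 x k]
      by_cases hxa : x = a
      · subst hxa
        simp only [if_true, if_neg hab, hav, h1 x v]; ring
      by_cases hxb : x = b
      · subst hxb
        simp only [if_true, if_neg hab.symm, hbv, h1 x v, hvab]; ring
      have : ω x v = 0 := by
        rw [h1]
        by_cases hxc : x = c
        · rw [hxc, hvc]
        · exact hvx x ⟨hxa, hxb, hxc⟩
      simp [hxa, hxb, this])
  have hva0 : ω v a = 0 := by
    have := hω' a b
    simp only [ha, hb, or_self, if_false, h2 a b hGab, zero_add, and_self, true_or,
      if_true] at this
    exact (mul_eq_zero.1 this).resolve_left hh0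
  have hv0 : ∀ x, ω v x = 0 := by
    intro x
    by_cases hxa : x = a
    · rw [hxa, hva0]
    by_cases hxb : x = b
    · rw [hxb, ← hvab, hva0]
    by_cases hxc : x = c
    · rw [hxc, hvc]
    exact hvx x ⟨hxa, hxb, hxc⟩
  intro x y
  by_cases hxv : x = v
  · rw [hxv, hv0]
  by_cases hyv : y = v
  · rw [h1, hyv, hv0]
  simpa [hxv, hyv, hva0] using hω' x y

/-- The vertex set `M` of `G` is contracted to its member `m` in `H`, and `K` is the part of `G`
inside `M`. -/
theorem exists_stressFree_of_contraction (hr : 0 < r) {K : SimpleGraph V} (M : Finset V) {m : V}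
    (hm : m ∈ M) (hK : ∃ p, StressFree K (dirs r p)) (hH : ∃ p, StressFree H (dirs r p))
    (hGK : ∀ x ∈ M, ∀ y ∈ M, G.Adj x y → K.Adj x y)
    (hGH : ∀ x ∉ M, ∀ y ∉ M, G.Adj x y → H.Adj x y)
    (hGm : ∀ x ∈ M, ∀ y ∉ M, G.Adj x y → H.Adj m y)
    (huniq : ∀ y ∉ M, ∀ x ∈ M, ∀ x' ∈ M, G.Adj x y → G.Adj x' y → x = x') :
    ∃ p, StressFree G (dirs r p) := by
  classical
  obtain ⟨p₁, h₁⟩ := hK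
  obtain ⟨p₂, h₂⟩ := hH
  -- A copy of `p₁` shrunk by t is inserted at the position of m. Inside M the directions are taken
  -- without the factor `signedPow r t`, so `D` stays nondegenerate at t = 0.
  let P : ℝ → V → Fin 2 → ℝ := fun t x => if x ∈ M then p₂ m + t • p₁ x else p₂ x
  let D : ℝ → V → V → Fin 2 → ℝ := fun t x y =>
    if x ∈ M ∧ y ∈ M then dirs r p₁ x y else dirs r (P t) x y
  have hP : ∀ x k, Continuous fun t => P t x k := by
    intro x k
    by_cases hx : x ∈ M
    · simp only [P, hx, if_true]
      fun_prop
    · simp only [P, hx, if_false]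
      fun_prop
  have hcont : Continuous D := by
    refine continuous_pi fun x => continuous_pi fun y => continuous_pi fun k => ?_
    by_cases hxy : x ∈ M ∧ y ∈ M
    · simp only [D, hxy, and_self, if_true]
      exact continuous_const
    · simp only [D, hxy, if_false]
      exact (continuous_signedPow hr).comp ((hP x k).sub (hP y k))
  have hD1 : ∀ x ∈ M, ∀ y ∈ M, D 0 x y = dirs r p₁ x y := fun x hx y hy => by simp [D, hx, hy]
  have hD2 : ∀ x ∉ M, ∀ y ∉ M, D 0 x y = dirs r p₂ x y := fun x hx y hy => by
    funext k; simp [D, P, hx, hy, dirs]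
  have hD3 : ∀ x ∈ M, ∀ y ∉ M, D 0 x y = dirs r p₂ m y := fun x hx y hy => by
    funext k; simp [D, P, hx, hy, dirs]
  have hD4 : ∀ x ∉ M, ∀ y ∈ M, D 0 x y = dirs r p₂ x m := fun x hx y hy => by
    funext k; simp [D, P, hx, hy, dirs]
  have hfree : StressFree G (D 0) := by
    intro ω h1 h2 h3
    have hsplit : ∀ f : V → ℝ, ∑ y, f y = ∑ y ∈ M, f y + ∑ y ∈ Mᶜ, f y := fun f =>
      (Finset.sum_add_sum_compl M f).symm
    -- Weights of edges leaving M are added up at m. Summing equilibrium over M cancels the internal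
    -- forces, so this is a stress of H.
    have hω := h₂ (fun x y =>
      if x ∈ M then (if y ∈ M then 0 else if x = m then ∑ z ∈ M, ω z y else 0)
      else (if y ∈ M then (if y = m then ∑ z ∈ M, ω z x else 0) else ω x y))
      (fun x y => by
        by_cases hx : x ∈ M <;> by_cases hy : y ∈ M <;> simp [hx, hy, h1 x y])
      (fun x y hxy => by
        by_cases hx : x ∈ M <;> by_cases hy : y ∈ M <;> simp only [hx, hy, if_true, if_false]
        · split_ifs with hxm
          · subst hxm
            exact Finset.sum_eq_zero fun z hz => h2 z y fun h => hxy (hGm z hz y hy h)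
          · rfl
        · split_ifs with hym
          · subst hym
            exact Finset.sum_eq_zero fun z hz => h2 z x fun h => hxy (hGm z hz x hx h).symm
          · rfl
        · exact h2 x y fun h => hxy (hGH x hx y hy h))
      (fun x k => by
        by_cases hx : x ∈ M
        · by_cases hxm : x = m
          · subst hxm
            have hin : ∑ z ∈ M, ∑ y ∈ M, ω z y * D 0 z y k = 0 := by
              have hneg : ∑ z ∈ M, ∑ y ∈ M, ω z y * D 0 z y k =
                  -∑ z ∈ M, ∑ y ∈ M, ω z y * D 0 z y k := by
                conv_lhs => rw [Finset.sum_comm]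
                rw [← Finset.sum_neg_distrib]
                refine Finset.sum_congr rfl fun y hy => ?_
                rw [← Finset.sum_neg_distrib]
                refine Finset.sum_congr rfl fun z hz => ?_
                rw [hD1 z hz y hy, hD1 y hy z hz, dirs_swap p₁ y z, h1 z y]
                ring
              linarith
            have hout : ∑ z ∈ M, ∑ y ∈ Mᶜ, ω z y * D 0 z y k = 0 := by
              have := Finset.sum_eq_zero (s := M) fun z _ => h3 z k
              simp only [hsplit, Finset.sum_add_distrib] at this
              linarith
            rw [hsplit, Finset.sum_eq_zero (s := M) (fun y hy => by simp [hx, hy]), zero_add,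
              ← hout, Finset.sum_comm]
            refine Finset.sum_congr rfl fun y hy => ?_
            have hy' : y ∉ M := by simpa using hy
            simp only [hx, hy', if_true, if_false, Finset.sum_mul]
            exact Finset.sum_congr rfl fun z hz => by rw [hD3 z hz y hy']
          · refine Finset.sum_eq_zero fun y _ => ?_
            simp [hx, hxm]
        · refine Eq.trans ?_ (h3 x k)
          rw [hsplit, hsplit fun y => ω x y * _]
          congr 1
          · rw [Finset.sum_eq_single m (fun y hy hym => by simp [hx, hy, hym])
              (fun h => absurd hm h)]
            simp only [hx, hm, if_true, if_false, Finset.sum_mul]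
            exact Finset.sum_congr rfl fun z hz => by rw [hD4 x hx z hz, h1]
          · refine Finset.sum_congr rfl fun y hy => ?_
            have hy' : y ∉ M := by simpa using hy
            simp only [hx, hy', if_false, hD2 x hx y hy'])
    -- By `huniq` each sum at m has at most one nonzero term, so its vanishing kills the individual
    -- weight.
    have hcross : ∀ x ∈ M, ∀ y ∉ M, ω x y = 0 := by
      intro x hx y hy
      by_cases hxy : G.Adj x y
      · have := hω m y
        simp only [hm, hy, if_true, if_false] at this
        rwa [Finset.sum_eq_single x (fun z hz hzx => h2 z y fun h =>
          hzx (huniq y hy z hz x hx h hxy)) (fun h => absurd hx h)] at this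
      · exact h2 x y hxy
    have hoff : ∀ x ∉ M, ∀ y, ω x y = 0 := by
      intro x hx y
      by_cases hy : y ∈ M
      · rw [h1]; exact hcross y hy x hx
      · simpa [hx, hy] using hω x y
    refine h₁ ω h1 (fun x y hxy => ?_) (fun x k => ?_)
    · by_cases hx : x ∈ M
      · by_cases hy : y ∈ M
        · exact h2 x y fun h => hxy (hGK x hx y hy h)
        · exact hcross x hx y hy
      · exact hoff x hx y
    · by_cases hx : x ∈ M
      · rw [← h3 x k]
        refine Finset.sum_congr rfl fun y _ => ?_
        by_cases hy : y ∈ M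
        · rw [hD1 x hx y hy]
        · rw [hcross x hx y hy, zero_mul, zero_mul]
      · exact Finset.sum_eq_zero fun y _ => by rw [hoff x hx y, zero_mul]
  have hev : ∀ᶠ t in 𝓝[>] (0 : ℝ), StressFree G (D t) :=
    (hcont.continuousAt.eventually_mem ((isOpen_stressFree G).mem_nhds hfree)).filter_mono
      nhdsWithin_le_nhds
  obtain ⟨t, ht, ht0⟩ := (hev.and self_mem_nhdsWithin).exists
  have ht0 : 0 < t := ht0
  refine ⟨P t, ht.of_scale (fun x y => if x ∈ M ∧ y ∈ M then (signedPow r t)⁻¹ else 1)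
    (fun x y => ?_) (fun x y => ?_) (fun x y k => ?_)⟩
  · split_ifs
    · exact inv_ne_zero fun h => ht0.ne' ((signedPow_eq_zero hr).1 h)
    · exact one_ne_zero
  · simp only [and_comm]
  · by_cases hxy : x ∈ M ∧ y ∈ M
    · have hs : signedPow r t ≠ 0 := fun h => ht0.ne' ((signedPow_eq_zero hr).1 h)
      have : P t x k - P t y k = t * (p₁ x k - p₁ y k) := by
        simp [P, hxy.1, hxy.2]; ring
      simp only [D, hxy, and_self, if_true]
      rw [dirs, dirs, this, signedPow_mul, inv_mul_cancel_left₀ hs]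
    · simp only [D, hxy, if_false, one_mul]

/-- All six possible edges are independent for this explicit placement. In the Euclidean case r = 1
the complete graph on four points in the plane always carries a stress. -/
theorem exists_stressFree_of_card_four (hr : 0 < r) (hr1 : r ≠ 1) {v a b c : V}
    (hva : v ≠ a) (hvb : v ≠ b) (hvc : v ≠ c) (hab : a ≠ b) (hac : a ≠ c) (hbc : b ≠ c)
    (hG : ∀ x y, G.Adj x y → x = v ∨ x = a ∨ x = b ∨ x = c) :
    ∃ p, StressFree G (dirs r p) := by
  classical
  let p : V → Fin 2 → ℝ := fun x =>
    if x = v then ![0, 0] else if x = a then ![1, 0] else if x = b then ![0, 1] else ![1 / 2, 1]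
  have hpv : p v = ![0, 0] := by simp [p]
  have hpa : p a = ![1, 0] := by simp [p, hva.symm]
  have hpb : p b = ![0, 1] := by simp [p, hvb.symm, hab.symm]
  have hpc : p c = ![1 / 2, 1] := by simp [p, hvc.symm, hac.symm, hbc.symm]
  refine ⟨p, fun ω h1 h2 h3 => ?_⟩
  have hout : ∀ x y, ¬ (x = v ∨ x = a ∨ x = b ∨ x = c) → ω x y = 0 := fun x y hx =>
    h2 x y fun h => hx (hG x y h)
  have hdiag : ∀ x, ω x x = 0 := fun x => h2 x x (G.irrefl)
  have hsum : ∀ x k, ω x v * dirs r p x v k + (ω x a * dirs r p x a k + (ω x b * dirs r p x b k +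
      ω x c * dirs r p x c k)) = 0 := by
    intro x k
    rw [← h3 x k, ← Finset.sum_subset (Finset.subset_univ {v, a, b, c})
      (fun y _ hy => by rw [h1, hout y x (by simpa using hy), zero_mul]),
      Finset.sum_insert (by simp [hva, hvb, hvc]), Finset.sum_insert (by simp [hab, hac]),
      Finset.sum_insert (by simp [hbc]), Finset.sum_singleton]
  set X := signedPow r (1 / 2) with hX
  have hneg : ∀ x, signedPow r (-x) = -signedPow r x := signedPow_neg r
  have hhalf : (1 : ℝ) - 2⁻¹ = 2⁻¹ := by norm_num
  have hX' : signedPow r 2⁻¹ = X := by rw [hX]; norm_num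
  have hX0 : X ≠ 0 := fun h0 => by
    have := (signedPow_eq_zero hr).1 h0
    norm_num at this
  have hX2 : 2 * X ≠ 1 := by
    intro h
    rw [hX, signedPow_of_pos (by norm_num), one_div, Real.inv_rpow (by norm_num)] at h
    have h2r : (2 : ℝ) ^ r = 2 ^ (1 : ℝ) := by
      rw [Real.rpow_one]
      field_simp at h
      linarith
    exact hr1 ((Real.rpow_right_inj (by norm_num) (by norm_num)).1 h2r)
  have v0 := hsum v 0
  have v1 := hsum v 1
  have a0 := hsum a 0
  have a1 := hsum a 1
  have b0 := hsum b 0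
  have b1 := hsum b 1
  simp [dirs, hpv, hpa, hpb, hpc, hneg, hhalf, hX', hdiag] at v0 v1 a0 a1 b0 b1
  rw [h1 a v] at a0
  rw [h1 b v] at b1
  rw [h1 b a] at b0 b1
  -- Eliminating the other weights leaves a factor that vanishes only when (1/2)^r = 1/2, that is, r
  -- = 1.
  have e : ω a b * (2 * X - 1) = 0 := by
    linear_combination -a0 - v0 - X * a1 + X * (b1 + v1)
  have ab0 := (mul_eq_zero.1 e).resolve_right (sub_ne_zero.2 hX2)
  have vb0 : ω v b = 0 := by linear_combination b1 - ab0
  have vc0 : ω v c = 0 := by linear_combination -v1 - vb0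
  have va0 : ω v a = 0 := by linear_combination -v0 - X * vc0
  have ac0 : ω a c = 0 := by linear_combination -a1 - ab0
  have bc0 : ω b c = 0 :=
    (mul_eq_zero.1 (by linear_combination -b0 - ab0 : ω b c * X = 0)).resolve_right hX0
  intro x y
  by_cases hx : x = v ∨ x = a ∨ x = b ∨ x = c
  · by_cases hy : y = v ∨ y = a ∨ y = b ∨ y = c
    · rcases hx with rfl | rfl | rfl | rfl <;> rcases hy with rfl | rfl | rfl | rfl <;>
        first
        | exact hdiag _
        | assumption
        | (rw [h1]; assumption)
    · rw [h1]; exact hout y x hy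
  · exact hout x y hx

end Moves

/-! ### Sparsity counts, tight sets and the inductive construction. -/

section Counting

open Classical

variable {V : Type*} {G H : SimpleGraph V} {X Y : Finset V}

/-- The number of neighbours of `a` in `X`. -/
noncomputable def degIn (G : SimpleGraph V) (a : V) (X : Finset V) : ℕ :=
  ∑ b ∈ X, if G.Adj a b then 1 else 0

/-- The number of ordered pairs of adjacent vertices in `X × Y`. -/
noncomputable def adjCount (G : SimpleGraph V) (X Y : Finset V) : ℕ := ∑ a ∈ X, degIn G a Y

/-- `(2,2)`-sparsity, with every edge counted twice. -/
def AdjSparse (G : SimpleGraph V) : Prop :=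
  ∀ X : Finset V, X.Nonempty → adjCount G X X + 4 ≤ 4 * X.card

theorem degIn_eq_card (a : V) : degIn G a X = (X.filter (G.Adj a)).card :=
  (Finset.card_filter _ _).symm

theorem adjCount_comm : adjCount G X Y = adjCount G Y X := by
  simp only [adjCount, degIn]
  rw [Finset.sum_comm]
  simp only [G.adj_comm]

theorem adjCount_mono_left {X' : Finset V} (h : X ⊆ X') : adjCount G X Y ≤ adjCount G X' Y :=
  Finset.sum_le_sum_of_subset h

theorem degIn_le_of_imp {a a' : V} (h : ∀ b ∈ X, G.Adj a b → H.Adj a' b) :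
    degIn G a X ≤ degIn H a' X := by
  refine Finset.sum_le_sum fun b hb => ?_
  split_ifs with h1 h2
  · exact le_rfl
  · exact absurd (h b hb h1) h2
  · exact zero_le
  · exact le_rfl

theorem adjCount_le_of_imp (h : ∀ a ∈ X, ∀ b ∈ Y, G.Adj a b → H.Adj a b) :
    adjCount G X Y ≤ adjCount H X Y :=
  Finset.sum_le_sum fun a ha => degIn_le_of_imp (h a ha)

theorem AdjSparse.mono (h : AdjSparse G) (hH : H ≤ G) : AdjSparse H := fun X hX =>
  (Nat.add_le_add_right (adjCount_le_of_imp fun _ _ _ _ hab => hH hab) 4).trans (h X hX)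

theorem adjCount_union (h : Disjoint X Y) :
    adjCount G (X ∪ Y) (X ∪ Y) = adjCount G X X + adjCount G Y Y + 2 * adjCount G X Y := by
  have h1 : ∀ Z, adjCount G (X ∪ Y) Z = adjCount G X Z + adjCount G Y Z := fun Z =>
    Finset.sum_union h
  rw [h1, adjCount_comm (X := X), adjCount_comm (X := Y), h1, h1, adjCount_comm (X := Y) (Y := X)]
  ring

theorem adjCount_singleton (v : V) : adjCount G {v} X = degIn G v X := by
  simp [adjCount]

theorem adjCount_insert {v : V} (hv : v ∉ X) :
    adjCount G (insert v X) (insert v X) = adjCount G X X + 2 * degIn G v X := by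
  rw [Finset.insert_eq, adjCount_union (by simpa using hv), adjCount_singleton, adjCount_singleton]
  simp [degIn]

theorem even_adjCount (G : SimpleGraph V) (X : Finset V) : Even (adjCount G X X) := by
  induction X using Finset.induction_on with
  | empty => simp [adjCount]
  | insert a s ha ih => rw [adjCount_insert ha]; exact ih.add (even_two_mul _)

theorem adjCount_eq_of_isolated (h : X ⊆ Y) (hiso : ∀ x ∈ Y \ X, ∀ y, ¬ G.Adj x y) :
    adjCount G Y Y = adjCount G X X := by
  have h0 : ∀ Z, adjCount G (Y \ X) Z = 0 := fun Z =>
    Finset.sum_eq_zero fun x hx => Finset.sum_eq_zero fun y _ => if_neg (hiso x hx y)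
  conv_lhs => rw [← Finset.union_sdiff_of_subset h]
  rw [adjCount_union Finset.disjoint_sdiff, h0, adjCount_comm (X := X) (Y := Y \ X), h0]
  rfl

/-- Only pairs between X \ Y and Y \ X are gained on the right. Hence, in a sparse graph, tight sets
that meet have a tight union. -/
theorem adjCount_supermodular (G : SimpleGraph V) (X Y : Finset V) :
    adjCount G X X + adjCount G Y Y ≤
      adjCount G (X ∪ Y) (X ∪ Y) + adjCount G (X ∩ Y) (X ∩ Y) := by
  have hX : X = (X \ Y) ∪ (X ∩ Y) := (Finset.sdiff_union_inter X Y).symm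
  have hY : Y = (Y \ X) ∪ (X ∩ Y) := by rw [Finset.inter_comm, Finset.sdiff_union_inter]
  have hXY : X ∪ Y = (X \ Y) ∪ Y := Finset.sdiff_union_self_eq_union.symm
  have d1 : Disjoint (X \ Y) (X ∩ Y) := Finset.disjoint_sdiff_inter X Y
  have e1 : adjCount G X X = adjCount G (X \ Y) (X \ Y) + adjCount G (X ∩ Y) (X ∩ Y) +
      2 * adjCount G (X \ Y) (X ∩ Y) := by
    conv_lhs => rw [hX]
    exact adjCount_union d1
  have e2 : adjCount G (X \ Y) (X ∩ Y) ≤ adjCount G (X \ Y) Y := by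
    rw [adjCount_comm, adjCount_comm (Y := Y)]
    exact adjCount_mono_left Finset.inter_subset_right
  rw [hXY, adjCount_union Finset.sdiff_disjoint]
  omega

theorem le_degIn_of_subset {a : V} {N : Finset V} (hN : N ⊆ X) (h : ∀ x ∈ N, G.Adj a x) :
    N.card ≤ degIn G a X := by
  rw [degIn_eq_card]
  exact Finset.card_le_card fun x hx => Finset.mem_filter.2 ⟨hN hx, h x hx⟩

/-- The edges of `G` with both end points in `X`. -/
def inside (G : SimpleGraph V) (X : Finset V) : SimpleGraph V where
  Adj a b := G.Adj a b ∧ a ∈ X ∧ b ∈ X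
  symm := ⟨fun _ _ h => ⟨h.1.symm, h.2.2, h.2.1⟩⟩
  loopless := ⟨fun _ h => G.irrefl h.1⟩

theorem inside_le (G : SimpleGraph V) (X : Finset V) : inside G X ≤ G := fun _ _ h => h.1

/-- No neighbourhood of a vertex of degree at least three lies in a tight set avoiding it. -/
theorem AdjSparse.lt_of_three_neighbors (hG : AdjSparse G) {v a b c : V} (hab : a ≠ b)
    (hac : a ≠ c) (hbc : b ≠ c) (ha : G.Adj v a) (hb : G.Adj v b) (hc : G.Adj v c)
    (haX : a ∈ X) (hbX : b ∈ X) (hcX : c ∈ X) (hv : v ∉ X) :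
    adjCount G X X + 4 < 4 * X.card := by
  have h1 := hG (insert v X) (Finset.insert_nonempty _ _)
  rw [adjCount_insert hv, Finset.card_insert_of_notMem hv] at h1
  have h2 : 3 ≤ degIn G v X := by
    have : ({a, b, c} : Finset V).card = 3 := by simp [hab, hac, hbc]
    rw [← this]
    refine le_degIn_of_subset ?_ ?_
    · simp [Finset.insert_subset_iff, haX, hbX, hcX]
    · simp [ha, hb, hc]
  omega

/-- The edge `xy` cannot be added to `G - v`: it is present, or `x` and `y` lie in a tight set. -/
def Blocked (G : SimpleGraph V) (v x y : V) : Prop :=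
  G.Adj x y ∨ ∃ X : Finset V, x ∈ X ∧ y ∈ X ∧ v ∉ X ∧ 4 * X.card ≤ adjCount G X X + 4

/-- No tight set avoiding v contains a, b and c. If ab were blocked by a tight set X, then ac and bc
must be edges, since a tight set blocking either could be united with X; but then X together with c
is tight, a contradiction. -/
theorem AdjSparse.adj_of_blocked (hG : AdjSparse G) {v a b c : V} (hab : a ≠ b)
    (hac : a ≠ c) (hbc : b ≠ c) (ha : G.Adj v a) (hb : G.Adj v b) (hc : G.Adj v c)
    (h1 : Blocked G v a b) (h2 : Blocked G v a c) (h3 : Blocked G v b c) : G.Adj a b := by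
  have no : ∀ X : Finset V, a ∈ X → b ∈ X → c ∈ X → v ∉ X → 4 * X.card ≤ adjCount G X X + 4 →
      False := fun X haX hbX hcX hv h =>
    absurd (hG.lt_of_three_neighbors hab hac hbc ha hb hc haX hbX hcX hv) (not_lt.2 h)
  have union : ∀ X Y : Finset V, (X ∩ Y).Nonempty → 4 * X.card ≤ adjCount G X X + 4 →
      4 * Y.card ≤ adjCount G Y Y + 4 → 4 * (X ∪ Y).card ≤ adjCount G (X ∪ Y) (X ∪ Y) + 4 := by
    intro X Y hne hX hY
    have e1 := adjCount_supermodular G X Y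
    have e2 := hG _ hne
    have e3 := Finset.card_union_add_card_inter X Y
    omega
  rcases h1 with h1 | ⟨X, haX, hbX, hvX, hX⟩
  · exact h1
  exfalso
  by_cases hcX : c ∈ X
  · exact no X haX hbX hcX hvX hX
  have hac' : G.Adj a c := h2.resolve_right fun ⟨Y, haY, hcY, hvY, hY⟩ =>
    no (X ∪ Y) (by simp [haX]) (by simp [hbX]) (by simp [hcY]) (by simp [hvX, hvY])
      (union X Y ⟨a, by simp [haX, haY]⟩ hX hY)
  have hbc' : G.Adj b c := h3.resolve_right fun ⟨Y, hbY, hcY, hvY, hY⟩ =>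
    no (X ∪ Y) (by simp [haX]) (by simp [hbX]) (by simp [hcY]) (by simp [hvX, hvY])
      (union X Y ⟨b, by simp [hbX, hbY]⟩ hX hY)
  refine no (insert c X) (by simp [haX]) (by simp [hbX]) (by simp) (by simp [hvX, hc.ne]) ?_
  have : 2 ≤ degIn G c X := by
    rw [← Finset.card_pair hab]
    exact le_degIn_of_subset (by simp [Finset.insert_subset_iff, haX, hbX])
      (by simp [hac'.symm, hbc'.symm])
  rw [adjCount_insert hcX, Finset.card_insert_of_notMem hcX]
  omega

theorem degIn_sup_edge_le {a b x : V} :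
    degIn (G ⊔ SimpleGraph.edge a b) x X ≤
      degIn G x X + ((if x = a then 1 else 0) + if x = b then 1 else 0) := by
  refine (Finset.sum_le_sum (g := fun y => (if G.Adj x y then 1 else 0) +
    ((if y = b then (if x = a then 1 else 0) else 0) +
      if y = a then (if x = b then 1 else 0) else 0)) fun y _ => ?_).trans ?_
  · by_cases hxy : G.Adj x y
    · simp [hxy]
    · by_cases hxy' : x = a ∧ y = b ∨ x = b ∧ y = a
      · rcases hxy' with ⟨rfl, rfl⟩ | ⟨rfl, rfl⟩ <;> simp <;> split_ifs <;> simp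
      · simp [SimpleGraph.edge_adj, hxy, hxy']
  · rw [Finset.sum_add_distrib, Finset.sum_add_distrib, Finset.sum_ite_eq', Finset.sum_ite_eq']
    refine Nat.add_le_add_left (Nat.add_le_add ?_ ?_) _ <;> split_ifs <;> simp

theorem adjCount_sup_edge_le {a b : V} :
    adjCount (G ⊔ SimpleGraph.edge a b) X X ≤ adjCount G X X + 2 := by
  refine (Finset.sum_le_sum fun x _ => degIn_sup_edge_le).trans ?_
  rw [Finset.sum_add_distrib, Finset.sum_add_distrib, Finset.sum_ite_eq', Finset.sum_ite_eq']
  refine Nat.add_le_add_left ?_ _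
  split_ifs <;> simp

/-- If adding the edge `ab` destroys sparsity, then `a` and `b` lie in a tight set. -/
theorem AdjSparse.exists_tight_of_not_sup_edge (hG : AdjSparse G) {a b : V}
    (h : ¬ AdjSparse (G ⊔ SimpleGraph.edge a b)) :
    ∃ X : Finset V, a ∈ X ∧ b ∈ X ∧ 4 * X.card ≤ adjCount G X X + 4 := by
  simp only [AdjSparse, not_forall, not_le] at h
  obtain ⟨X, hne, hX⟩ := h
  by_cases hab : a ∈ X ∧ b ∈ X
  · refine ⟨X, hab.1, hab.2, ?_⟩
    have h1 := adjCount_sup_edge_le (G := G) (X := X) (a := a) (b := b)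
    obtain ⟨m, hm⟩ := even_adjCount G X
    omega
  · have : adjCount (G ⊔ SimpleGraph.edge a b) X X ≤ adjCount G X X := by
      refine adjCount_le_of_imp fun x hx y hy hxy => ?_
      rcases hxy with hxy | hxy
      · exact hxy
      · rw [SimpleGraph.edge_adj] at hxy
        rcases hxy.1 with ⟨rfl, rfl⟩ | ⟨rfl, rfl⟩ <;> tauto
    have := hG X hne
    omega

theorem AdjSparse.sup_edge_of_not_blocked (hG : AdjSparse G) {v a b : V} {S : Finset V}
    (ha : a ≠ v) (hb : b ≠ v) (h : ¬ Blocked G v a b) :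
    AdjSparse (inside G (S.erase v) ⊔ SimpleGraph.edge a b) := by
  by_contra hs
  obtain ⟨X, haX, hbX, hX⟩ := (hG.mono (inside_le G _)).exists_tight_of_not_sup_edge hs
  refine h (Or.inr ⟨X.erase v, by simp [ha, haX], by simp [hb, hbX], by simp, ?_⟩)
  have h1 : adjCount (inside G (S.erase v)) X X =
      adjCount (inside G (S.erase v)) (X.erase v) (X.erase v) :=
    adjCount_eq_of_isolated (Finset.erase_subset _ _) fun x hx y hxy => by
      have : x = v := by
        simp only [Finset.mem_sdiff, Finset.mem_erase, not_and, ne_eq] at hx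
        by_contra hxv
        exact hx.2 hxv hx.1
      subst this
      simpa using hxy.2.1
  have h2 : adjCount (inside G (S.erase v)) (X.erase v) (X.erase v) ≤
      adjCount G (X.erase v) (X.erase v) := adjCount_le_of_imp fun _ _ _ _ h => h.1
  have h3 : (X.erase v).card ≤ X.card := Finset.card_erase_le
  omega

/-- Contraction of `M` to the vertex `m`. -/
def contract (G : SimpleGraph V) (M : Finset V) (m : V) (hm : m ∈ M) : SimpleGraph V where
  Adj x y := (x ∉ M ∧ y ∉ M ∧ G.Adj x y) ∨ (x = m ∧ y ∉ M ∧ ∃ z ∈ M, G.Adj z y) ∨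
    (y = m ∧ x ∉ M ∧ ∃ z ∈ M, G.Adj z x)
  symm := ⟨fun _ _ h => by
    rcases h with h | h | h
    · exact Or.inl ⟨h.2.1, h.1, h.2.2.symm⟩
    · exact Or.inr (Or.inr h)
    · exact Or.inr (Or.inl h)⟩
  loopless := ⟨fun x h => by
    rcases h with h | h | h
    · exact G.irrefl h.2.2
    · exact h.2.1 (h.1 ▸ hm)
    · exact h.2.1 (h.1 ▸ hm)⟩

/-- For X containing m, apply sparsity of G to X ∪ M and subtract the tight count of M; merging
parallel edges only lowers the count. -/
theorem AdjSparse.contraction (hG : AdjSparse G) {M : Finset V} {m : V} (hm : m ∈ M)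
    (hM : 4 * M.card ≤ adjCount G M M + 4) : AdjSparse (contract G M m hm) := by
  intro X hX
  have hZle : adjCount (contract G M m hm) (X \ M) (X \ M) ≤
      adjCount G (X \ M) (X \ M) := by
    refine adjCount_le_of_imp fun x hx y hy hxy => ?_
    rw [Finset.mem_sdiff] at hx hy
    rcases hxy with h | h | h
    · exact h.2.2
    · exact absurd (h.1 ▸ hm) hx.2
    · exact absurd (h.1 ▸ hm) hy.2
  by_cases hmX : m ∈ X
  · have hmZ : m ∉ X \ M := by simp [hm]
    have hsub : insert m (X \ M) ⊆ X := by simp [Finset.insert_subset_iff, hmX]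
    rw [adjCount_eq_of_isolated hsub fun x hx y hxy => by
      simp only [Finset.mem_sdiff, Finset.mem_insert, not_or, not_and, not_not] at hx
      rcases hxy with h | h | h
      · exact h.1 (hx.2.2 hx.1)
      · exact hx.2.1 h.1
      · exact h.2.1 (hx.2.2 hx.1), adjCount_insert hmZ]
    have hdeg : degIn (contract G M m hm) m (X \ M) ≤ adjCount G (X \ M) M := by
      refine Finset.sum_le_sum fun y hy => ?_
      split_ifs with h
      · obtain ⟨z, hz, hzy⟩ : ∃ z ∈ M, G.Adj z y := by
          rcases h with h | h | h
          · exact absurd hm h.1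
          · exact h.2.2
          · exact absurd hm h.2.1
        rw [← Finset.card_singleton z]
        exact le_degIn_of_subset (by simpa using hz) (by simpa using hzy.symm)
      · exact zero_le
    have h1 := hG ((X \ M) ∪ M) ⟨m, by simp [hm]⟩
    rw [adjCount_union Finset.sdiff_disjoint, Finset.card_union_of_disjoint Finset.sdiff_disjoint]
      at h1
    have h2 := Finset.card_le_card hsub
    rw [Finset.card_insert_of_notMem hmZ] at h2
    omega
  · rw [adjCount_eq_of_isolated (Finset.sdiff_subset (t := M)) fun x hx y hxy => by
      simp only [Finset.mem_sdiff, not_and, not_not] at hx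
      rcases hxy with h | h | h
      · exact h.1 (hx.2 hx.1)
      · exact hmX (h.1 ▸ hx.1)
      · exact h.2.1 (hx.2 hx.1)]
    rcases (X \ M).eq_empty_or_nonempty with hZ | hZ
    · have := hX.card_pos
      rw [hZ]
      simp only [adjCount, Finset.sum_empty]
      omega
    · have h1 := hG _ hZ
      have h2 : (X \ M).card ≤ X.card := Finset.card_le_card Finset.sdiff_subset
      omega

variable [Fintype V] {r : ℝ}

/-- Every `(2,2)`-sparse graph has a placement without equilibrium stresses. -/
theorem AdjSparse.exists_stressFree (hr : 0 < r) (hr1 : r ≠ 1) (hG : AdjSparse G) :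
    ∃ p, StressFree G (dirs r p) := by
  -- The vertex type stays fixed: deleted vertices become isolated, and the induction runs on a set
  -- S carrying all edges.
  suffices ∀ S : Finset V, ∀ G : SimpleGraph V, AdjSparse G → (∀ a b, G.Adj a b → a ∈ S) →
      ∃ p, StressFree G (dirs r p) from this Finset.univ G hG fun _ _ _ => Finset.mem_univ _
  intro S
  induction S using Finset.strongInduction with
  | H S ih =>
  intro G hG hS
  have hS' : ∀ a b, G.Adj a b → b ∈ S := fun a b h => hS b a h.symm
  rcases S.eq_empty_or_nonempty with rfl | hne
  · exact ⟨0, fun ω _ h2 _ a b => h2 a b fun h => by simpa using hS a b h⟩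
  have hdel : ∀ v ∈ S, ∃ p, StressFree (inside G (S.erase v)) (dirs r p) := fun v hv =>
    ih _ (Finset.erase_ssubset hv) _ (hG.mono (inside_le G _)) fun a b h => h.2.1
  have hdelv : ∀ v x, ¬ (inside G (S.erase v)).Adj v x := fun v x h => by simpa using h.2.1
  have hdelG : ∀ v a b, G.Adj a b → a ≠ v → b ≠ v → (inside G (S.erase v)).Adj a b :=
    fun v a b h ha hb => ⟨h, by simp [ha, hS a b h], by simp [hb, hS' a b h]⟩
  by_cases hdeg2 : ∃ v ∈ S, degIn G v S ≤ 2
  · obtain ⟨v, hv, hdeg⟩ := hdeg2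
    have hN : ∃ a b, ∀ x, G.Adj v x → x = a ∨ x = b := by
      rw [degIn_eq_card] at hdeg
      have hmem : ∀ x, G.Adj v x → x ∈ S.filter (G.Adj v) := fun x hx =>
        Finset.mem_filter.2 ⟨hS' v x hx, hx⟩
      obtain h | h | h : (S.filter (G.Adj v)).card = 0 ∨ (S.filter (G.Adj v)).card = 1 ∨
        (S.filter (G.Adj v)).card = 2 := by omega
      · rw [Finset.card_eq_zero] at h
        exact ⟨v, v, fun x hx => by simpa [h] using hmem x hx⟩
      · obtain ⟨a, ha⟩ := Finset.card_eq_one.1 h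
        exact ⟨a, a, fun x hx => by simpa [ha] using hmem x hx⟩
      · obtain ⟨a, b, -, hab⟩ := Finset.card_eq_two.1 h
        exact ⟨a, b, fun x hx => by simpa [hab] using hmem x hx⟩
    obtain ⟨a, b, hN⟩ := hN
    by_cases hadj : ∃ x, G.Adj v x
    · obtain ⟨x, hx⟩ := hadj
      have hxv := hx.ne'
      by_cases ha : a = v
      · exact exists_stressFree_of_pair hr hxv hxv (hdel v hv) (hdelv v) (hdelG v) fun y hy => by
          rcases hN x hx with h | h <;> rcases hN y hy with h' | h'
          · exact absurd (h.trans ha) hxv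
          · exact absurd (h.trans ha) hxv
          · exact absurd (h'.trans ha) hy.ne'
          · exact Or.inl (h'.trans h.symm)
      by_cases hb : b = v
      · exact exists_stressFree_of_pair hr ha ha (hdel v hv) (hdelv v) (hdelG v) fun y hy => by
          rcases hN y hy with h' | h'
          · exact Or.inl h'
          · exact absurd (h'.trans hb) hy.ne'
      exact exists_stressFree_of_pair hr ha hb (hdel v hv) (hdelv v) (hdelG v) hN
    · push Not at hadj
      obtain ⟨p, hp⟩ := hdel v hv
      refine ⟨p, hp.mono fun x y hxy => hdelG v x y hxy ?_ ?_⟩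
      · rintro rfl; exact hadj _ hxy
      · rintro rfl; exact hadj _ hxy.symm
  push Not at hdeg2
  -- Sparsity keeps the average degree below 4.
  obtain ⟨v, hv, hdeg⟩ : ∃ v ∈ S, degIn G v S ≤ 3 := by
    by_contra! h
    have h1 : S.card * 4 ≤ adjCount G S S := by
      rw [← smul_eq_mul]
      exact Finset.card_nsmul_le_sum S _ 4 fun v hv => h v hv
    have h2 := hG S hne
    omega
  have h3 : (S.filter (G.Adj v)).card = 3 := by
    rw [← degIn_eq_card]
    have := hdeg2 v hv
    omega
  obtain ⟨a, b, c, hab, hac, hbc, hN⟩ := Finset.card_eq_three.1 h3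
  have hmem : ∀ x, G.Adj v x ↔ x = a ∨ x = b ∨ x = c := fun x => by
    have : x ∈ S.filter (G.Adj v) ↔ x = a ∨ x = b ∨ x = c := by simp [hN]
    rw [← this, Finset.mem_filter]
    exact ⟨fun h => ⟨hS' v x h, h⟩, fun h => h.2⟩
  have ha : G.Adj v a := (hmem a).2 (by simp)
  have hb : G.Adj v b := (hmem b).2 (by simp)
  have hc : G.Adj v c := (hmem c).2 (by simp)
  have hsub : ∀ x y z, G.Adj v x → G.Adj v y → G.Adj v z → x ≠ y → z ≠ x → z ≠ y →
      (∀ w, G.Adj v w → w = x ∨ w = y ∨ w = z) → ¬ Blocked G v x y →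
      ∃ p, StressFree G (dirs r p) := by
    intro x y z hx hy hz hxy hzx hzy hw hbl
    refine exists_stressFree_of_subdivision hr hx.ne' hy.ne' hz.ne' hzx hzy
      (H := inside G (S.erase v) ⊔ SimpleGraph.edge x y)
      (ih _ (Finset.erase_ssubset hv) _ (hG.sup_edge_of_not_blocked hx.ne' hy.ne' hbl) ?_)
      ?_ ?_ (fun h => hbl (Or.inl h)) (fun s t h hs ht => Or.inl (hdelG v s t h hs ht)) hw
    · rintro s t (h | h)
      · exact h.2.1
      · rw [SimpleGraph.edge_adj] at h
        rcases h.1 with h | h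
        · rw [h.1]; simp [hx.ne', hS' v x hx]
        · rw [h.1]; simp [hy.ne', hS' v y hy]
    · rintro s (h | h)
      · exact hdelv v s h
      · rw [SimpleGraph.edge_adj] at h
        rcases h.1 with h | h
        · exact hx.ne h.1
        · exact hy.ne h.1
    · exact Or.inr (by rw [SimpleGraph.edge_adj]; exact ⟨Or.inl ⟨rfl, rfl⟩, hxy⟩)
  by_cases b1 : Blocked G v a b
  swap
  · exact hsub a b c ha hb hc hab hac.symm hbc.symm (fun w hw => (hmem w).1 hw) b1
  by_cases b2 : Blocked G v a c
  swap
  · exact hsub a c b ha hc hb hac hab.symm hbc (fun w hw => by have := (hmem w).1 hw; tauto) b2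
  by_cases b3 : Blocked G v b c
  swap
  · exact hsub b c a hb hc ha hbc hab hac (fun w hw => by have := (hmem w).1 hw; tauto) b3
  have symm : ∀ {x y}, Blocked G v x y → Blocked G v y x := fun h =>
    h.imp (fun h => h.symm) fun ⟨X, h1, h2, h3⟩ => ⟨X, h2, h1, h3⟩
  have hGab : G.Adj a b := hG.adj_of_blocked hab hac hbc ha hb hc b1 b2 b3
  have hGac : G.Adj a c := hG.adj_of_blocked hac hab hbc.symm ha hc hb b2 b1 (symm b3)
  have hGbc : G.Adj b c := hG.adj_of_blocked hbc hab.symm hac.symm hb hc ha b3 (symm b1) (symm b2)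
  have hKcard : ({v, a, b, c} : Finset V).card = 4 := by
    simp [ha.ne, hb.ne, hc.ne, hab, hac, hbc]
  have hKS : ({v, a, b, c} : Finset V) ⊆ S := by
    simp [Finset.insert_subset_iff, hv, hS' v a ha, hS' v b hb, hS' v c hc]
  have hKtight : 4 * ({v, a, b, c} : Finset V).card ≤
      adjCount G {v, a, b, c} {v, a, b, c} + 4 := by
    have d3 : ({a, b, c} : Finset V).card ≤ degIn G v {a, b, c} :=
      le_degIn_of_subset (Finset.Subset.refl _) (by simp [ha, hb, hc])
    have d2 : ({b, c} : Finset V).card ≤ degIn G a {b, c} :=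
      le_degIn_of_subset (Finset.Subset.refl _) (by simp [hGab, hGac])
    have d1 : ({c} : Finset V).card ≤ degIn G b {c} :=
      le_degIn_of_subset (Finset.Subset.refl _) (by simp [hGbc])
    rw [Finset.card_eq_three.2 ⟨a, b, c, hab, hac, hbc, rfl⟩] at d3
    rw [Finset.card_pair hbc] at d2
    rw [Finset.card_singleton] at d1
    rw [hKcard, adjCount_insert (by simp [ha.ne, hb.ne, hc.ne]),
      adjCount_insert (by simp [hab, hac]), adjCount_insert (by simp [hbc])]
    omega
  by_cases hSK : S = {v, a, b, c}
  · exact exists_stressFree_of_card_four hr hr1 ha.ne hb.ne hc.ne hab hac hbc fun x y h => by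
      simpa [hSK] using hS x y h
  -- Maximality among proper tight sets ensures that a vertex outside M has at most one neighbour in
  -- M, as contraction requires.
  obtain ⟨M, hM, hMmax⟩ := Finset.exists_max_image
    (S.ssubsets.filter fun T => {v, a, b, c} ⊆ T ∧ 4 * T.card ≤ adjCount G T T + 4) Finset.card
    ⟨{v, a, b, c}, by
      simp only [Finset.mem_filter, Finset.mem_ssubsets]
      exact ⟨Finset.ssubset_iff_subset_ne.2 ⟨hKS, Ne.symm hSK⟩, Finset.Subset.refl _, hKtight⟩⟩
  simp only [Finset.mem_filter, Finset.mem_ssubsets] at hM hMmax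
  obtain ⟨hMS, hKM, hMt⟩ := hM
  have hvM : v ∈ M := hKM (by simp)
  have haM : a ∈ M := hKM (by simp)
  refine exists_stressFree_of_contraction hr M hvM (K := inside G M) (H := contract G M v hvM)
    (ih M hMS _ (hG.mono (inside_le G _)) fun x y h => h.2.1)
    (ih (S \ M ∪ {v}) ?_ _ (hG.contraction hvM hMt) ?_) (fun x hx y hy h => ⟨h, hx, hy⟩)
    (fun x hx y hy h => Or.inl ⟨hx, hy, h⟩) (fun x hx y hy h => Or.inr (Or.inl ⟨rfl, hy, x, hx, h⟩))
    ?_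
  · refine Finset.ssubset_iff_subset_ne.2 ⟨?_, fun h => ?_⟩
    · intro x hx
      simp only [Finset.mem_union, Finset.mem_sdiff, Finset.mem_singleton] at hx
      rcases hx with hx | rfl
      · exact hx.1
      · exact hv
    · have : a ∈ S \ M ∪ {v} := by rw [h]; exact hMS.1 haM
      simp [haM, ha.ne'] at this
  · intro x y h
    simp only [Finset.mem_union, Finset.mem_sdiff, Finset.mem_singleton]
    rcases h with h | h | h
    · exact Or.inl ⟨hS x y h.2.2, h.1⟩
    · exact Or.inr h.1
    · obtain ⟨z, -, hz⟩ := h.2.2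
      exact Or.inl ⟨hS' z x hz, h.2.1⟩
  · intro y hy x hx x' hx' hxy hxy'
    by_contra hne'
    have hd : 2 ≤ degIn G y M := by
      rw [← Finset.card_pair hne']
      exact le_degIn_of_subset (by simp [Finset.insert_subset_iff, hx, hx'])
        (by simp [hxy.symm, hxy'.symm])
    have hyS : y ∈ S := hS' x y hxy
    have hsubset : insert y M ⊆ S := Finset.insert_subset hyS hMS.1
    -- Two neighbours in M would make M with y tight. If that set is all of S, maximality says
    -- nothing, but then y has degree at least 3 into M and sparsity of S fails.
    by_cases hins : insert y M = S
    · have h1 := hG S hne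
      rw [← hins, adjCount_insert hy, Finset.card_insert_of_notMem hy] at h1
      have h2 := hdeg2 y hyS
      have h3 : degIn G y S = degIn G y M := by
        rw [← hins, degIn, Finset.sum_insert hy]
        simp [degIn]
      omega
    · have := hMmax (insert y M) ⟨Finset.ssubset_iff_subset_ne.2 ⟨hsubset, hins⟩,
        hKM.trans (Finset.subset_insert _ _), by
          rw [adjCount_insert hy, Finset.card_insert_of_notMem hy]
          omega⟩
      rw [Finset.card_insert_of_notMem hy] at this
      omega

end Counting

/-! ### First-order behaviour of the norm and trivial flexes. -/

section Analysis

variable {q : ℝ≥0∞} [Fact (1 ≤ q)]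

theorem hasDerivAt_norm_comp (hq1 : 1 < q) (hqtop : q < ⊤)
    {h : ℝ → PiLp q (fun _ : Fin 2 => ℝ)} {w : PiLp q (fun _ : Fin 2 => ℝ)}
    (hh : HasDerivAt h w 0) (h0 : h 0 ≠ 0) :
    ∃ c : ℝ, c ≠ 0 ∧
      HasDerivAt (fun t => ‖h t‖) (c * ∑ k, signedPow (q.toReal - 1) (h 0 k) * w k) 0 := by
  have hQ : 1 < q.toReal := by
    rw [← ENNReal.toReal_one]
    exact (ENNReal.toReal_lt_toReal ENNReal.one_ne_top hqtop.ne).2 hq1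
  have hQ0 : 0 < q.toReal := zero_lt_one.trans hQ
  set Q := q.toReal with hQdef
  have hk : ∀ k, HasDerivAt (fun t => h t k) (w k) 0 := fun k =>
    (PiLp.proj (𝕜 := ℝ) q (fun _ : Fin 2 => ℝ) k).hasFDerivAt.comp_hasDerivAt (0 : ℝ) hh
  have hg : HasDerivAt (fun t => ∑ k, |h t k| ^ Q)
      (∑ k, Q * |h 0 k| ^ (Q - 2) * h 0 k * w k) 0 :=
    HasDerivAt.fun_sum fun k _ => HasDerivAt.comp (h₂ := fun x : ℝ => |x| ^ Q) (0 : ℝ)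
      (hasDerivAt_abs_rpow (h 0 k) hQ) (hk k)
  have hpos : 0 < ∑ k, |h 0 k| ^ Q := by
    obtain ⟨k, hk0⟩ : ∃ k, h 0 k ≠ 0 := by
      by_contra! hc
      exact h0 (by ext k; exact hc k)
    exact Finset.sum_pos' (fun i _ => Real.rpow_nonneg (abs_nonneg _) _)
      ⟨k, Finset.mem_univ _, Real.rpow_pos_of_pos (abs_pos.2 hk0) _⟩
  have hn : (fun t => ‖h t‖) = fun t => (∑ k, |h t k| ^ Q) ^ (1 / Q) := by
    funext t
    rw [PiLp.norm_eq_sum hQ0]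
    simp only [Real.norm_eq_abs, hQdef]
  -- The factor is ‖h 0‖^(1 - Q), left by the chain rule after Q and 1/Q cancel.
  refine ⟨(∑ k, |h 0 k| ^ Q) ^ (1 / Q - 1), (Real.rpow_pos_of_pos hpos _).ne', ?_⟩
  rw [hn]
  convert hg.rpow_const (p := 1 / Q) (Or.inl hpos.ne') using 1
  have hs : ∀ x : ℝ, |x| ^ (Q - 2) * x = signedPow (Q - 1) x := by
    have key : ∀ x : ℝ, x ≠ 0 → |x| ^ (Q - 2) * |x| = |x| ^ (Q - 1) := fun x hx => by
      rw [← Real.rpow_add_one (abs_pos.2 hx).ne']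
      congr 1; ring
    intro x
    rcases lt_trichotomy x 0 with hx | rfl | hx
    · rw [signedPow, Real.sign_of_neg hx, ← key x hx.ne, abs_of_neg hx]; ring
    · simp
    · rw [signedPow, Real.sign_of_pos hx, ← key x hx.ne', abs_of_pos hx]; ring
  have hsum : ∑ k, Q * |h 0 k| ^ (Q - 2) * h 0 k * w k =
      Q * ∑ k, signedPow (Q - 1) (h 0 k) * w k := by
    rw [Finset.mul_sum]
    refine Finset.sum_congr rfl fun k _ => ?_
    rw [← hs]; ring
  rw [hsum]
  field_simp

/-- The first-order length condition on an edge of positive length. -/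
theorem isLittleO_norm_iff (hq1 : 1 < q) (hqtop : q < ⊤)
    {x y u v : PiLp q (fun _ : Fin 2 => ℝ)} (hxy : x ≠ y) :
    (fun t : ℝ => ‖(x + t • u) - (y + t • v)‖ - ‖x - y‖) =o[𝓝 0] (fun t : ℝ => t) ↔
      ∑ k, signedPow (q.toReal - 1) (x k - y k) * (u k - v k) = 0 := by
  have hd : HasDerivAt (fun t : ℝ => (x + t • u) - (y + t • v)) (u - v) 0 := by
    have h1 : ∀ z w : PiLp q (fun _ : Fin 2 => ℝ), HasDerivAt (fun t : ℝ => z + t • w) w 0 :=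
      fun z w => by simpa using ((hasDerivAt_id (0 : ℝ)).smul_const w).const_add z
    exact (h1 x u).sub (h1 y v)
  obtain ⟨c, hc, hder⟩ := hasDerivAt_norm_comp hq1 hqtop hd (by simpa [sub_eq_zero] using hxy)
  simp only [zero_smul, add_zero, PiLp.sub_apply] at hder
  have hiff : (fun t : ℝ => ‖(x + t • u) - (y + t • v)‖ - ‖x - y‖) =o[𝓝 0] (fun t : ℝ => t) ↔
      HasDerivAt (fun t : ℝ => ‖(x + t • u) - (y + t • v)‖) 0 0 := by
    rw [hasDerivAt_iff_isLittleO]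
    simp
  rw [hiff]
  constructor
  · intro h
    exact (mul_eq_zero.1 (hder.unique h)).resolve_left hc
  · intro h
    rwa [h, mul_zero] at hder

/-- The first-order length condition on an edge of length zero. -/
theorem isLittleO_norm_iff_of_eq {X : Type*} [NormedAddCommGroup X] [NormedSpace ℝ X]
    {x u v : X} :
    (fun t : ℝ => ‖(x + t • u) - (x + t • v)‖ - ‖x - x‖) =o[𝓝 0] (fun t : ℝ => t) ↔ u = v := by
  have h1 : (fun t : ℝ => ‖(x + t • u) - (x + t • v)‖ - ‖x - x‖) = fun t => ‖t‖ * ‖u - v‖ := by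
    funext t
    rw [add_sub_add_left_eq_sub, ← smul_sub, norm_smul]
    simp
  rw [h1]
  constructor
  · intro h
    by_contra huv
    have hne : ‖u - v‖ ≠ 0 := norm_ne_zero_iff.2 (sub_ne_zero.2 huv)
    have h2 : (fun t : ℝ => t) =o[𝓝 0] (fun t : ℝ => t) := by
      refine Asymptotics.IsLittleO.congr_left (Asymptotics.IsLittleO.const_mul_left
        (f := fun t : ℝ => ‖t‖ * ‖u - v‖) h ‖u - v‖⁻¹) (f₂ := fun t : ℝ => ‖t‖) ?_ |>.of_norm_left
      intro t
      field_simp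
    have h3 := h2.def (c := 1 / 2) (by norm_num)
    have h4 := (h3.filter_mono (nhdsWithin_le_nhds (s := {0}ᶜ))).and self_mem_nhdsWithin
    obtain ⟨t, ht, ht0⟩ := h4.exists
    have : 0 < ‖t‖ := norm_pos_iff.2 ht0
    linarith
  · rintro rfl
    simp

/-- A velocity field that preserves all distances to first order is constant. -/
theorem eq_of_forall_signedPow {r : ℝ} (hr : 0 < r) (hr1 : r ≠ 1) {f g : ℝ → ℝ → ℝ}
    (h : ∀ s t s' t', signedPow r (s - s') * (f s t - f s' t') +
      signedPow r (t - t') * (g s t - g s' t') = 0) (s t s' t' : ℝ) :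
    f s t = f s' t' ∧ g s t = g s' t' := by
  have hne : ∀ {x : ℝ}, x ≠ 0 → signedPow r x ≠ 0 := fun hx h0 => hx ((signedPow_eq_zero hr).1 h0)
  have hf : ∀ s s' t, f s t = f s' t := by
    intro s s' t
    by_cases hs : s = s'
    · rw [hs]
    have := h s t s' t
    simp only [sub_self, signedPow_zero, zero_mul, add_zero] at this
    exact sub_eq_zero.1 ((mul_eq_zero.1 this).resolve_left (hne (sub_ne_zero.2 hs)))
  have hg : ∀ s t t', g s t = g s t' := by
    intro s t t'
    by_cases ht : t = t'
    · rw [ht]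
    have := h s t s t'
    simp only [sub_self, signedPow_zero, zero_mul, zero_add] at this
    exact sub_eq_zero.1 ((mul_eq_zero.1 this).resolve_left (hne (sub_ne_zero.2 ht)))
  have h2 : signedPow r 2 ≠ 2 := by
    intro h2
    rw [signedPow_of_pos two_pos] at h2
    exact hr1 ((Real.rpow_right_inj (x := 2) two_pos (by norm_num)).1
      (h2.trans (Real.rpow_one 2).symm))
  have hf' : ∀ t t', f 0 t = f 0 t' := by
    intro t t'
    by_cases ht : t = t'
    · rw [ht]
    have hb : signedPow r (t - t') ≠ 0 := hne (sub_ne_zero.2 ht)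
    -- Here f no longer depends on s, nor g on t. Comparing horizontal steps of one and two times t
    -- - t' at the same height difference gives the factor 2^r - 2, which is nonzero as r ≠ 1.
    have e1 := h (t - t') t 0 t'
    have e2 := h (2 * (t - t')) t (t - t') t'
    have e3 := h (2 * (t - t')) t 0 t'
    rw [hf (t - t') 0, hg _ t t', sub_zero] at e1
    rw [hf (t - t') 0, hf (2 * (t - t')) 0, hg _ t t',
      show 2 * (t - t') - (t - t') = t - t' by ring] at e2
    rw [hf (2 * (t - t')) 0, hg _ t t', sub_zero, signedPow_mul] at e3
    have : signedPow r (t - t') * ((signedPow r 2 - 2) * (f 0 t - f 0 t')) = 0 := by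
      linear_combination e3 - e1 - e2
    exact sub_eq_zero.1 ((mul_eq_zero.1 ((mul_eq_zero.1 this).resolve_left hb)).resolve_left
      (sub_ne_zero.2 h2))
  refine ⟨by rw [hf s 0, hf s' 0, hf' t t'], ?_⟩
  have e := h s 1 s' 0
  rw [hf s 0, hf s' 0, hf' 1 0] at e
  simp only [sub_self, mul_zero, sub_zero, signedPow_one, one_mul, zero_add] at e
  rw [hg s t 1, hg s' t' 0]
  linarith

/-- Differentiating the isometry condition at 0 for all pairs of points of the plane makes the
velocity field constant; conversely, translations realise every constant field. -/
theorem isTrivial_iff {V : Type*} [Nonempty V] (hq1 : 1 < q) (hqtop : q < ⊤) (hq2 : q ≠ 2)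
    {p u : V → PiLp q (fun _ : Fin 2 => ℝ)} : IsTrivial p u ↔ ∀ a b, u a = u b := by
  have hr : 0 < q.toReal - 1 := by
    rw [sub_pos, ← ENNReal.toReal_one]
    exact (ENNReal.toReal_lt_toReal ENNReal.one_ne_top hqtop.ne).2 hq1
  have hr1 : q.toReal - 1 ≠ 1 := by
    intro h
    refine hq2 ((ENNReal.toReal_eq_toReal_iff' hqtop.ne ENNReal.ofNat_ne_top).1 ?_)
    rw [ENNReal.toReal_ofNat]
    linarith
  constructor
  · rintro ⟨γ, hγ, hu⟩ a b
    rw [hu, hu]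
    have key : ∀ x y, ∑ k, signedPow (q.toReal - 1) (x k - y k) *
        (deriv (γ x) 0 k - deriv (γ y) 0 k) = 0 := by
      intro x y
      by_cases hxy : x = y
      · simp [hxy]
      have hd := (hγ.differentiableAt x).hasDerivAt.sub (hγ.differentiableAt y).hasDerivAt
      obtain ⟨c, hc, hder⟩ := hasDerivAt_norm_comp hq1 hqtop hd
        (by simpa [hγ.map_zero, sub_eq_zero] using hxy)
      have hconst : (fun t => ‖(γ x - γ y) t‖) =ᶠ[𝓝 0] fun _ => ‖x - y‖ := by
        filter_upwards [Icc_mem_nhds (show (-1 : ℝ) < 0 by norm_num) zero_lt_one] with t ht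
        exact hγ.norm_sub t ht x y
      have := (hder.congr_of_eventuallyEq hconst.symm).unique (hasDerivAt_const _ _)
      simpa [hγ.map_zero, hc] using this
    have hkey := eq_of_forall_signedPow hr hr1
      (f := fun s t => deriv (γ (WithLp.toLp q ![s, t])) 0 0)
      (g := fun s t => deriv (γ (WithLp.toLp q ![s, t])) 0 1) (fun s t s' t' => by
        have := key (WithLp.toLp q ![s, t]) (WithLp.toLp q ![s', t'])
        simpa [Fin.sum_univ_two] using this) (p a 0) (p a 1) (p b 0) (p b 1)
    have hp : ∀ x : PiLp q (fun _ : Fin 2 => ℝ), WithLp.toLp q ![x 0, x 1] = x := fun x => by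
      ext k; fin_cases k <;> rfl
    rw [hp, hp] at hkey
    ext k
    fin_cases k
    · exact hkey.1
    · exact hkey.2
  · intro h
    obtain ⟨v⟩ := ‹Nonempty V›
    have hd : ∀ x : PiLp q (fun _ : Fin 2 => ℝ),
        HasDerivAt (fun t : ℝ => x + t • u v) (u v) 0 := fun x => by
      simpa using ((hasDerivAt_id (0 : ℝ)).smul_const (u v)).const_add x
    refine ⟨fun x t => x + t • u v, ⟨fun x => by fun_prop, fun x => (hd x).differentiableAt,
      fun x => by simp, fun t _ x y => by simp⟩, fun w => ?_⟩
    rw [(hd _).deriv, h w v]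

end Analysis

/-! ### Comparison of edge counts with doubled adjacency counts. -/

theorem ncard_edgeSet_inside {V : Type*} [Fintype V] (G : SimpleGraph V) (X : Finset V) :
    2 * (inside G X).edgeSet.ncard = adjCount G X X := by
  classical
  have h1 : adjCount G X X = adjCount (inside G X) Finset.univ Finset.univ := by
    rw [adjCount_eq_of_isolated (Finset.subset_univ X) fun x hx y hxy => by
      simp only [Finset.mem_sdiff] at hx
      exact hx.2 hxy.2.1]
    exact le_antisymm (adjCount_le_of_imp fun a ha b hb h => ⟨h, ha, hb⟩)
      (adjCount_le_of_imp fun a ha b hb h => h.1)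
  rw [h1, Set.ncard_eq_toFinset_card', Set.toFinset_card, ← SimpleGraph.edgeFinset_card,
    ← SimpleGraph.sum_degrees_eq_twice_card_edges, adjCount]
  refine Finset.sum_congr rfl fun a _ => ?_
  rw [degIn_eq_card, ← SimpleGraph.card_neighborFinset_eq_degree,
    SimpleGraph.neighborFinset_eq_filter]

theorem isTwoTwoSparse_iff {V : Type*} [Fintype V] {G : SimpleGraph V} :
    IsTwoTwoSparse G ↔ AdjSparse G := by
  classical
  constructor
  · intro h X hX
    have h1 := h ((⊤ : G.Subgraph).induce (X : Set V)) (by simpa using hX)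
    have h2 : ((⊤ : G.Subgraph).induce (X : Set V)).edgeSet = (inside G X).edgeSet := by
      ext e
      induction e using Sym2.ind with
      | _ a b =>
        simp only [SimpleGraph.Subgraph.mem_edgeSet, SimpleGraph.Subgraph.induce_adj,
          SimpleGraph.Subgraph.top_adj, SimpleGraph.mem_edgeSet, inside, Finset.mem_coe]
        tauto
    rw [h2, SimpleGraph.Subgraph.induce_verts, Set.ncard_coe_finset] at h1
    have h3 := ncard_edgeSet_inside G X
    omega
  · intro h K hK
    have h1 := h K.verts.toFinset (by simpa using hK)
    have h2 : K.edgeSet.ncard ≤ (inside G K.verts.toFinset).edgeSet.ncard := by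
      refine Set.ncard_le_ncard (fun e he => ?_) (Set.toFinite _)
      induction e using Sym2.ind with
      | _ a b =>
        have hab : K.Adj a b := he
        exact ⟨K.adj_sub hab, by simpa using K.edge_vert hab, by simpa using K.edge_vert hab.symm⟩
    have h3 := ncard_edgeSet_inside G K.verts.toFinset
    rw [Set.ncard_eq_toFinset_card' K.verts]
    omega

/-! ### Rank of the rigidity matrix and dimension of the flex space. -/

section Rank

variable {V : Type*} [Fintype V] [DecidableEq V] {q : ℝ≥0∞} {G H : SimpleGraph V}
  {p : V → PiLp q (fun _ : Fin 2 => ℝ)}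

/-- The directions of the pairs of vertices of a placement in the plane with the `q`-norm. -/
noncomputable abbrev edgeDirs (q : ℝ≥0∞) (p : V → PiLp q (fun _ : Fin 2 => ℝ)) :
    V → V → Fin 2 → ℝ :=
  dirs (q.toReal - 1) fun a k => p a k

theorem rigidityEntry_eq_sum (e : Sym2 V) (v : V) (k : Fin 2) :
    rigidityEntry q p e v k = ∑ b, if e = s(v, b) then edgeDirs q p v b k else 0 := by
  induction e using Sym2.ind with
  | _ i j =>
  simp only [rigidityEntry, Sym2.lift_mk]
  by_cases hij : i = j
  · subst hij
    rw [sub_self]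
    refine (Finset.sum_eq_zero fun b _ => ?_).symm
    split_ifs with h
    · rw [Sym2.eq_iff] at h
      have : v = b := by rcases h with ⟨rfl, rfl⟩ | ⟨rfl, rfl⟩ <;> rfl
      simp [this, dirs]
    · rfl
  by_cases hvi : v = i
  · subst hvi
    rw [Finset.sum_eq_single j (fun b _ hb => if_neg fun h => hb (by
      rw [Sym2.eq_iff] at h
      rcases h with h | h
      · exact h.2.symm
      · exact absurd h.2.symm hij)) (by simp)]
    simp [hij, dirs]
  by_cases hvj : v = j
  · subst hvj
    rw [Finset.sum_eq_single i (fun b _ hb => if_neg fun h => hb (by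
      rw [Sym2.eq_iff] at h
      rcases h with h | h
      · exact absurd h.1.symm hvi
      · exact h.1.symm)) (by simp)]
    rw [if_neg hvi, if_pos rfl, if_pos Sym2.eq_swap, edgeDirs, dirs_swap, dirs]
    ring
  · rw [if_neg hvi, if_neg hvj, sub_zero]
    refine (Finset.sum_eq_zero fun b _ => if_neg fun h => ?_).symm
    rw [Sym2.eq_iff] at h
    rcases h with h | h
    · exact hvi h.1.symm
    · exact hvj h.2.symm

theorem sum_mul_rigidityMatrix [Fintype G.edgeSet] {W : Sym2 V → ℝ}
    (hW : ∀ e ∉ G.edgeSet, W e = 0) (v : V) (k : Fin 2) :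
    ∑ e : G.edgeSet, W e * rigidityMatrix q G p e (v, k) =
      ∑ b, W s(v, b) * edgeDirs q p v b k := by
  rw [Fintype.sum_of_injective (fun e : G.edgeSet => (e : Sym2 V)) Subtype.val_injective
    (fun e => W e * rigidityMatrix q G p e (v, k)) (fun e => W e * rigidityEntry q p e v k)
    (fun e he => by rw [hW e (by simpa using he), zero_mul]) (fun e => rfl)]
  simp only [rigidityEntry_eq_sum, Finset.mul_sum]
  rw [Finset.sum_comm]
  refine Finset.sum_congr rfl fun b _ => ?_
  simp

theorem stressFree_iff_linearIndependent :
    StressFree G (edgeDirs q p) ↔ LinearIndependent ℝ (rigidityMatrix q G p).row := by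
  classical
  rw [Fintype.linearIndependent_iff]
  constructor
  · intro h c hc e
    let W : Sym2 V → ℝ := fun e => if he : e ∈ G.edgeSet then c ⟨e, he⟩ else 0
    have hW : ∀ e ∉ G.edgeSet, W e = 0 := fun e he => dif_neg he
    have hWc : ∀ e : G.edgeSet, W e = c e := fun e => dif_pos e.2
    have := h (fun a b => W s(a, b)) (fun a b => by rw [Sym2.eq_swap])
      (fun a b hab => hW _ (by simpa using hab)) (fun a k => by
        rw [← sum_mul_rigidityMatrix hW]
        have := congrFun hc (a, k)
        simpa [hWc, Matrix.row, Finset.sum_apply] using this)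
    rw [← hWc]
    obtain ⟨e, he⟩ := e
    induction e using Sym2.ind with
    | _ a b => exact this a b
  · intro h ω h1 h2 h3
    let W : Sym2 V → ℝ := Sym2.lift ⟨ω, h1⟩
    have hW : ∀ e ∉ G.edgeSet, W e = 0 := fun e he => by
      induction e using Sym2.ind with
      | _ a b => exact h2 a b (by simpa using he)
    have := h (fun e => W e) (by
      funext c
      have := (sum_mul_rigidityMatrix (q := q) (p := p) hW c.1 c.2).trans (h3 c.1 c.2)
      simpa [Matrix.row, Finset.sum_apply] using this)
    intro a b
    by_cases hab : G.Adj a b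
    · exact this ⟨s(a, b), hab⟩
    · exact h2 a b hab

theorem StressFree.rank_eq (h : StressFree G (edgeDirs q p)) :
    (rigidityMatrix q G p).rank = G.edgeSet.ncard := by
  classical
  rw [(stressFree_iff_linearIndependent.1 h).rank_matrix, ← Nat.card_coe_set_eq,
    Nat.card_eq_fintype_card]

theorem rank_le_ncard_edgeSet : (rigidityMatrix q G p).rank ≤ G.edgeSet.ncard := by
  classical
  rw [← Nat.card_coe_set_eq, Nat.card_eq_fintype_card]
  exact Matrix.rank_le_card_height _

theorem StressFree.ncard_le_rank (h : StressFree H (edgeDirs q p)) (hH : H ≤ G) :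
    H.edgeSet.ncard ≤ (rigidityMatrix q G p).rank := by
  rw [← h.rank_eq]
  exact Matrix.rank_submatrix_le (rigidityMatrix q G p)
    (fun e : H.edgeSet => ⟨e.1, SimpleGraph.edgeSet_mono hH e.2⟩) id

/-- B consists of the edges of a row basis. -/
theorem exists_stressFree_ncard_eq_rank (q : ℝ≥0∞) (G : SimpleGraph V)
    (p : V → PiLp q (fun _ : Fin 2 => ℝ)) :
    ∃ B ≤ G, StressFree B (edgeDirs q p) ∧ B.edgeSet.ncard = (rigidityMatrix q G p).rank := by
  classical
  obtain ⟨κ, a, ha, hspan, hli⟩ := exists_linearIndependent' ℝ (rigidityMatrix q G p).row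
  have hedge : (SimpleGraph.fromEdgeSet (Set.range fun i => (a i : Sym2 V))).edgeSet =
      Set.range fun i => (a i : Sym2 V) := by
    rw [SimpleGraph.edgeSet_fromEdgeSet, sdiff_eq_left, Set.disjoint_left]
    rintro _ ⟨i, rfl⟩ hd
    exact G.not_isDiag_of_mem_edgeSet (a i).2 hd
  have hle : SimpleGraph.fromEdgeSet (Set.range fun i => (a i : Sym2 V)) ≤ G := by
    rw [← SimpleGraph.edgeSet_subset_edgeSet, hedge]
    rintro _ ⟨i, rfl⟩
    exact (a i).2
  have hex : ∀ e : (SimpleGraph.fromEdgeSet (Set.range fun i => (a i : Sym2 V))).edgeSet,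
      ∃ i, (a i : Sym2 V) = e := fun e => by
    have he : (e : Sym2 V) ∈ Set.range fun i => (a i : Sym2 V) := hedge.subset e.2
    exact he
  choose f hf using hex
  refine ⟨_, hle, ?_, ?_⟩
  · rw [stressFree_iff_linearIndependent]
    have hinj : Function.Injective f := fun e e' h => Subtype.ext (by rw [← hf e, ← hf e', h])
    have hrow : (rigidityMatrix q
        (SimpleGraph.fromEdgeSet (Set.range fun i => (a i : Sym2 V))) p).row =
        ((rigidityMatrix q G p).row ∘ a) ∘ f := by
      funext e c
      change rigidityEntry q p e c.1 c.2 = rigidityEntry q p (a (f e)) c.1 c.2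
      rw [hf]
    rw [hrow]
    exact hli.comp f hinj
  · have := Fintype.ofInjective a ha
    rw [hedge, Matrix.rank_eq_finrank_span_row, ← hspan, finrank_span_eq_card hli,
      ← Nat.card_eq_fintype_card, ← Set.ncard_univ, ← Set.image_univ]
    exact Set.ncard_image_of_injective _ (Subtype.val_injective.comp ha)

/-- The velocities that satisfy the linearised length conditions of all edges. -/
noncomputable def flexSpace (q : ℝ≥0∞) (G : SimpleGraph V)
    (p : V → PiLp q (fun _ : Fin 2 => ℝ)) : Submodule ℝ (V × Fin 2 → ℝ) :=
  LinearMap.ker (rigidityMatrix q G p).mulVecLin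

theorem mem_flexSpace {u : V × Fin 2 → ℝ} :
    u ∈ flexSpace q G p ↔
      ∀ a b, G.Adj a b → ∑ k, edgeDirs q p a b k * (u (a, k) - u (b, k)) = 0 := by
  have key : ∀ a b (h : G.Adj a b), (rigidityMatrix q G p).mulVec u ⟨s(a, b), h⟩ =
      ∑ k, edgeDirs q p a b k * (u (a, k) - u (b, k)) := by
    intro a b h
    simp only [Matrix.mulVec, dotProduct, Fintype.sum_prod_type, rigidityMatrix, Matrix.of_apply,
      rigidityEntry, Sym2.lift_mk]
    rw [Finset.sum_comm]
    refine Finset.sum_congr rfl fun k _ => ?_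
    simp only [sub_mul, ite_mul, zero_mul, Finset.sum_sub_distrib, Finset.sum_ite_eq',
      Finset.mem_univ, if_true, dirs]
    ring
  rw [flexSpace, LinearMap.mem_ker, Matrix.mulVecLin_apply]
  constructor
  · intro h a b hab
    rw [← key a b hab, h]
    rfl
  · intro h
    funext e
    obtain ⟨e, he⟩ := e
    induction e using Sym2.ind with
    | _ a b => exact (key a b he).trans (h a b he)

theorem rank_add_finrank_flexSpace :
    (rigidityMatrix q G p).rank + Module.finrank ℝ (flexSpace q G p) = 2 * Fintype.card V := by
  rw [Matrix.rank, flexSpace, LinearMap.finrank_range_add_finrank_ker, Module.finrank_pi]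
  simp [mul_comm]

theorem flexSpace_anti (h : H ≤ G) : flexSpace q G p ≤ flexSpace q H p := fun u hu => by
  rw [mem_flexSpace] at hu ⊢
  exact fun a b hab => hu a b (h hab)

/-- The velocities that are constant on `X`. -/
def constOn (X : Finset V) : Submodule ℝ (V × Fin 2 → ℝ) where
  carrier := {u | ∀ a ∈ X, ∀ b ∈ X, ∀ k, u (a, k) = u (b, k)}
  add_mem' := fun {x y} hx hy a ha b hb k => by simp [hx a ha b hb k, hy a ha b hb k]
  zero_mem' := fun _ _ _ _ _ => rfl
  smul_mem' := fun c x hx a ha b hb k => by simp [hx a ha b hb k]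

theorem finrank_constOn {X : Finset V} (hX : X.Nonempty) :
    Module.finrank ℝ (constOn X) + 2 * X.card = 2 * Fintype.card V + 2 := by
  obtain ⟨x, hx⟩ := hX
  let E : constOn X ≃ₗ[ℝ] ({y // y ∈ insert x Xᶜ} × Fin 2 → ℝ) :=
    { toFun := fun u c => u.1 (c.1, c.2)
      map_add' := fun _ _ => rfl
      map_smul' := fun _ _ => rfl
      invFun := fun u => ⟨fun c => if h : c.1 ∈ X then u (⟨x, by simp⟩, c.2)
          else u (⟨c.1, by simp [h]⟩, c.2), fun a ha b hb k => by simp [ha, hb]⟩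
      left_inv := fun u => by
        ext ⟨a, k⟩
        by_cases h : a ∈ X
        · simp [h, u.2 x hx a h k]
        · simp [h]
      right_inv := fun u => by
        funext ⟨⟨a, ha⟩, k⟩
        by_cases h : a ∈ X
        · have : a = x := by simpa [h] using ha
          subst this
          simp [h]
        · simp [h] }
  rw [E.finrank_eq, Module.finrank_pi, Fintype.card_prod, Fintype.card_coe, Fintype.card_fin,
    Finset.card_insert_of_notMem (by simpa using hx), Finset.card_compl]
  have := X.card_le_univ
  omega

theorem constOn_le_flexSpace {X : Finset V} (h : ∀ a b, G.Adj a b → a ∈ X) :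
    constOn X ≤ flexSpace q G p := fun u hu => by
  rw [mem_flexSpace]
  exact fun a b hab => Finset.sum_eq_zero fun k _ => by
    rw [hu a (h a b hab) b (h b a hab.symm) k, sub_self, mul_zero]

/-- The rows inside X are independent and vanish on fields constant on X, a space of dimension 2|V|
- 2|X| + 2; this bounds their number. -/
theorem StressFree.adjSparse (h : StressFree G (edgeDirs q p)) : AdjSparse G := by
  intro X hX
  have h1 := (h.mono (inside_le G X)).rank_eq
  have h2 := rank_add_finrank_flexSpace (G := inside G X) (p := p)
  have h3 := Submodule.finrank_mono
    (constOn_le_flexSpace (q := q) (p := p) (G := inside G X) (X := X) fun a b h => h.2.1)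
  have h4 := finrank_constOn hX
  have h5 := ncard_edgeSet_inside G X
  omega

/-- A stress-free framework moves every tight set of vertices rigidly. -/
theorem StressFree.mem_constOn (h : StressFree G (edgeDirs q p)) {X : Finset V}
    (hX : X.Nonempty) (ht : 4 * X.card ≤ adjCount G X X + 4) {u : V × Fin 2 → ℝ}
    (hu : u ∈ flexSpace q G p) : u ∈ constOn X := by
  have h1 := (h.mono (inside_le G X)).rank_eq
  have h2 := rank_add_finrank_flexSpace (G := inside G X) (p := p)
  have h4 := finrank_constOn hX
  have h5 := ncard_edgeSet_inside G X
  rw [Submodule.eq_of_le_of_finrank_le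
    (constOn_le_flexSpace (q := q) (p := p) (G := inside G X) (X := X) fun a b h => h.2.1)
    (by omega)]
  exact flexSpace_anti (inside_le G X) hu

end Rank

/-! ### Regular placements of tight graphs. -/

section Placements

variable {V : Type*} [Fintype V] {q : ℝ≥0∞} {G : SimpleGraph V}
  {p u : V → PiLp q (fun _ : Fin 2 => ℝ)}

theorem StressFree.placement_ne (h : StressFree G (edgeDirs q p)) {a b : V} (hab : G.Adj a b) :
    p a ≠ p b := fun hp => h.ne_of_adj hab (by simp only [hp])

theorem isTrivial_iff_mem_constOn [Fact (1 ≤ q)] [Nonempty V] (hq1 : 1 < q)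
    (hqtop : q < ⊤) (hq2 : q ≠ 2) :
    IsTrivial p u ↔ (fun c => u c.1 c.2) ∈ constOn (Finset.univ : Finset V) := by
  rw [isTrivial_iff hq1 hqtop hq2]
  constructor
  · intro h a _ b _ k
    simp only [h a b]
  · intro h a b
    ext k
    exact h a (Finset.mem_univ _) b (Finset.mem_univ _) k

theorem exists_stressFree_edgeDirs (hq1 : 1 < q) (hqtop : q < ⊤) (hq2 : q ≠ 2)
    (hG : AdjSparse G) : ∃ p : V → PiLp q (fun _ : Fin 2 => ℝ), StressFree G (edgeDirs q p) := by
  obtain ⟨p, hp⟩ := hG.exists_stressFree (r := q.toReal - 1)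
    (sub_pos.2 (by simpa using (ENNReal.toReal_lt_toReal ENNReal.one_ne_top hqtop.ne).2 hq1))
    (fun h => hq2 ((ENNReal.toReal_eq_toReal_iff' hqtop.ne ENNReal.ofNat_ne_top).1 (by
      rw [ENNReal.toReal_ofNat]; linarith)))
  exact ⟨fun a => WithLp.toLp q (p a), hp⟩

/-- Some placement has rank |E|, so by regularity the given one does too, and its row basis is all
of G. -/
theorem IsTwoTwoTight.stressFree [DecidableEq V] (hq1 : 1 < q) (hqtop : q < ⊤) (hq2 : q ≠ 2)
    (hp : IsRegular q G p) (hG : IsTwoTwoTight G) : StressFree G (edgeDirs q p) := by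
  obtain ⟨B, hBG, hB, hcard⟩ := exists_stressFree_ncard_eq_rank q G p
  obtain ⟨p', hp'⟩ := exists_stressFree_edgeDirs hq1 hqtop hq2 (isTwoTwoSparse_iff.1 hG.1)
  have h1 := (hp'.ncard_le_rank le_rfl).trans (hp p')
  rw [← hcard] at h1
  have h2 := Set.eq_of_subset_of_ncard_le (SimpleGraph.edgeSet_mono hBG) h1 (Set.toFinite _)
  rwa [SimpleGraph.edgeSet_inj.1 h2] at hB

end Placements

/-! ### Flexes, and redundancy of edges outside a row basis. -/

section Rigidity

variable {V : Type*} [Fintype V] [DecidableEq V] {q : ℝ≥0∞} [Fact (1 ≤ q)] {G : SimpleGraph V}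
  {p u : V → PiLp q (fun _ : Fin 2 => ℝ)}

/-- Zero-length edges give zero rows, so this direction needs no condition on the placement; the
converse does. -/
theorem IsInfinitesimalFlex.mem_flexSpace (hq1 : 1 < q) (hqtop : q < ⊤)
    (hu : IsInfinitesimalFlex G p u) : (fun c => u c.1 c.2) ∈ flexSpace q G p := by
  rw [BarJoint.mem_flexSpace]
  intro a b hab
  by_cases hp : p a = p b
  · simp [dirs, hp]
  · exact (isLittleO_norm_iff hq1 hqtop hp).1 (hu a b hab)

theorem isInfinitesimalFlex_iff_mem_flexSpace (hq1 : 1 < q) (hqtop : q < ⊤)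
    (hp : ∀ a b, G.Adj a b → p a ≠ p b) :
    IsInfinitesimalFlex G p u ↔ (fun c => u c.1 c.2) ∈ flexSpace q G p := by
  refine ⟨fun h => h.mem_flexSpace hq1 hqtop, fun h a b hab => ?_⟩
  rw [mem_flexSpace] at h
  exact (isLittleO_norm_iff hq1 hqtop (hp a b hab)).2 (h a b hab)

/-- At a regular placement no edge outside a maximal stress-free subgraph `B` restricts the
infinitesimal flexes of `B`. -/
theorem eq_of_minimallyInfinitesimallyRigid (hq1 : 1 < q) (hqtop : q < ⊤) (hq2 : q ≠ 2)
    (hp : IsRegular q G p) (hmin : MinimallyInfinitesimallyRigid G p) {B : SimpleGraph V}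
    (hBG : B ≤ G) (hB : StressFree B (edgeDirs q p))
    (hcard : B.edgeSet.ncard = (rigidityMatrix q G p).rank) : B = G := by
  refine le_antisymm hBG fun a b hab => ?_
  by_contra hnB
  obtain ⟨u, hu, hnt⟩ := hmin.2 s(a, b) hab
  refine hmin.1 ⟨u, fun c d hcd => ?_, hnt⟩
  by_cases he : s(c, d) = s(a, b)
  swap
  · exact hu c d (by rw [SimpleGraph.deleteEdges_adj]; exact ⟨hcd, by simpa using he⟩)
  have hnB' : ¬ B.Adj c d := by
    rw [← SimpleGraph.mem_edgeSet, he]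
    exact hnB
  have hBle : B ≤ G.deleteEdges {s(a, b)} := fun x y hxy => by
    rw [SimpleGraph.deleteEdges_adj]
    refine ⟨hBG hxy, fun h => hnB ?_⟩
    rw [← SimpleGraph.mem_edgeSet, ← Set.mem_singleton_iff.1 h]
    exact hxy
  have huB : (fun c : V × Fin 2 => u c.1 c.2) ∈ flexSpace q B p :=
    flexSpace_anti hBle (hu.mem_flexSpace hq1 hqtop)
  by_cases hcdp : p c = p d
  -- Were B with cd sparse, it would be stress-free at another placement, of rank greater than the
  -- regular one.
  · have hns : ¬ AdjSparse (B ⊔ SimpleGraph.edge c d) := by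
      intro hs
      obtain ⟨p', hp'⟩ := exists_stressFree_edgeDirs hq1 hqtop hq2 hs
      have hle : B ⊔ SimpleGraph.edge c d ≤ G := by
        refine sup_le hBG fun x y hxy => ?_
        rw [SimpleGraph.edge_adj] at hxy
        rcases hxy.1 with ⟨rfl, rfl⟩ | ⟨rfl, rfl⟩
        · exact hcd
        · exact hcd.symm
      have h1 := (hp'.ncard_le_rank hle).trans (hp p')
      have h2 : B.edgeSet.ncard < (B ⊔ SimpleGraph.edge c d).edgeSet.ncard := by
        refine Set.ncard_lt_ncard ?_ (Set.toFinite _)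
        rw [SimpleGraph.edgeSet_ssubset_edgeSet]
        refine lt_of_le_of_ne le_sup_left fun h => hnB' ?_
        rw [h]
        exact Or.inr (by rw [SimpleGraph.edge_adj]; exact ⟨Or.inl ⟨rfl, rfl⟩, hcd.ne⟩)
      omega
    obtain ⟨X, hcX, hdX, hX⟩ := hB.adjSparse.exists_tight_of_not_sup_edge hns
    have hconst := hB.mem_constOn ⟨c, hcX⟩ hX huB
    have hucd : u c = u d := by
      ext k
      exact hconst c hcX d hdX k
    rw [hcdp]
    exact isLittleO_norm_iff_of_eq.2 hucd
  · rw [isLittleO_norm_iff hq1 hqtop hcdp]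
    have h1 := rank_add_finrank_flexSpace (G := G) (p := p)
    have h2 := rank_add_finrank_flexSpace (G := B) (p := p)
    rw [hB.rank_eq, hcard] at h2
    -- B and G have equal rank, so their flex spaces coincide.
    rw [← Submodule.eq_of_le_of_finrank_le (flexSpace_anti hBG) (by omega), mem_flexSpace] at huB
    exact huB c d hcd

end Rigidity

end BarJoint

open BarJoint in
theorem theorem3p6 {V : Type*} [Fintype V] [DecidableEq V] [Nonempty V]
    (q : ℝ≥0∞) [Fact (1 ≤ q)] (hq1 : 1 < q) (hqtop : q < ⊤) (hq2 : q ≠ 2)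
    (G : SimpleGraph V) (p : V → PiLp q (fun _ : Fin 2 => ℝ))
    (hp : BarJoint.IsRegular q G p) :
    BarJoint.MinimallyInfinitesimallyRigid G p ↔ BarJoint.IsTwoTwoTight G := by
  have hconst := finrank_constOn (V := V) Finset.univ_nonempty
  rw [Finset.card_univ] at hconst
  have hV : 0 < Fintype.card V := Fintype.card_pos
  constructor
  · intro hmin
    obtain ⟨B, hBG, hB, hcard⟩ := exists_stressFree_ncard_eq_rank q G p
    obtain rfl := eq_of_minimallyInfinitesimallyRigid hq1 hqtop hq2 hp hmin hBG hB hcard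
    refine ⟨isTwoTwoSparse_iff.2 hB.adjSparse, ?_⟩
    have hle : flexSpace q B p ≤ constOn Finset.univ := by
      intro w hw
      by_contra hnt
      refine hmin.1 ⟨fun a => WithLp.toLp q fun k => w (a, k), ?_, ?_⟩
      · exact (isInfinitesimalFlex_iff_mem_flexSpace hq1 hqtop
          fun a b hab => hB.placement_ne hab).2 hw
      · rwa [isTrivial_iff_mem_constOn hq1 hqtop hq2]
    have hge : constOn Finset.univ ≤ flexSpace q B p :=
      constOn_le_flexSpace fun a _ _ => Finset.mem_univ a
    have h1 := rank_add_finrank_flexSpace (G := B) (p := p)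
    rw [le_antisymm hle hge] at h1
    rw [Nat.card_eq_fintype_card]
    omega
  · intro hG
    have hfree := hG.stressFree hq1 hqtop hq2 hp
    have hne : ∀ a b, G.Adj a b → p a ≠ p b := fun a b hab => hfree.placement_ne hab
    have hcard := hG.2
    rw [Nat.card_eq_fintype_card] at hcard
    refine ⟨?_, fun e he => ?_⟩
    · rintro ⟨u, hu, hnt⟩
      refine hnt ((isTrivial_iff_mem_constOn hq1 hqtop hq2).2
        (hfree.mem_constOn Finset.univ_nonempty ?_ (hu.mem_flexSpace hq1 hqtop)))
      have h1 := ncard_edgeSet_inside G Finset.univ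
      have h2 : inside G Finset.univ = G := by
        ext a b
        simp [inside]
      rw [h2] at h1
      rw [Finset.card_univ]
      omega
    · have h1 := rank_add_finrank_flexSpace (G := G.deleteEdges {e}) (p := p)
      have h2 := rank_le_ncard_edgeSet (G := G.deleteEdges {e}) (p := p)
      have h3 : (G.deleteEdges {e}).edgeSet.ncard + 1 = G.edgeSet.ncard := by
        rw [SimpleGraph.edgeSet_deleteEdges]
        exact Set.ncard_sdiff_singleton_add_one he (Set.toFinite _)
      -- With 2|V| - 3 rows left, the flex space has dimension at least 3, but the constant fields
      -- only 2.
      have hnot : ¬ flexSpace q (G.deleteEdges {e}) p ≤ constOn Finset.univ := by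
        intro hle
        have := Submodule.finrank_mono hle
        omega
      obtain ⟨w, hw, hnt⟩ := SetLike.not_le_iff_exists.1 hnot
      refine ⟨fun a => WithLp.toLp q fun k => w (a, k), ?_, ?_⟩
      · exact (isInfinitesimalFlex_iff_mem_flexSpace hq1 hqtop
          fun a b hab => hne a b (G.deleteEdges_le {e} hab)).2 hw
      · rwa [isTrivial_iff_mem_constOn hq1 hqtop hq2]
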